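/- Let $t$ be a positive integer and let $\lambda=(\lambda_1,\dots,\lambda_r)$, $r\ge 1$, $\lambda_1\ge\lambda_2\ge\cdots\ge\lambda_r\ge 1$, be a partition. Fill its Young diagram (rows numbered from the top, columns from the left) by writing the integer $(r-j)t+i$ into the cell in row $j$ and column $i$, for $1\le j\le r$ and $1\le i\le\lambda_j$. The $t$-Young complex $\Delta_t^\lambda$ is the simplicial complex generated by all sets $\{a_1,\dots,a_{\lambda_1}\}$ such that $a_1<a_2<\cdots<a_{\lambda_1}$ and $a_i$ is an entry of the $i$-th column of the filling for every $1\le i\le\lambda_1$; equal integers in different cells are the same vertex. Then (the geometric realization of) $\Delta_t^\lambda$ is either contractible or homotopy equivalent to a wedge $S^{n_0}\vee S^{n_1}\vee\cdots\vee S^{n_k}$ of finitely many (at least one) spheres of dimensions $n_i\ge 0$, where the dimensions $n_i$ are allowed to differ. -/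

import Mathlib

/-- The filling of a Young diagram `μ` with `r = μ.colLen 0` rows and parameter `t`. Rows and columns
are indexed from `0` here, so that the cell in row `i` (counted from the top) and column `j` carries
the number `(r - (i + 1)) * t + (j + 1)`. It is only used for cells of `μ`, where `i + 1 ≤ r`. -/
def youngEntry (t : ℕ) (μ : YoungDiagram) (i j : ℕ) : ℕ :=
  (μ.colLen 0 - (i + 1)) * t + (j + 1)

/-- A strictly increasing sequence with one term for each column of `μ` (there are `μ.rowLen 0` of
them), whose `j`-th term is an entry of the `j`-th column. -/
def IsYoungSequence (t : ℕ) (μ : YoungDiagram) (a : Fin (μ.rowLen 0) → ℕ) : Prop :=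
  StrictMono a ∧ ∀ j : Fin (μ.rowLen 0), ∃ i : ℕ, (i, (j : ℕ)) ∈ μ ∧ a j = youngEntry t μ i j

/-- The `t`-Young complex: the simplicial complex generated by the sets
`{a₁ < a₂ < ⋯}` with `a_j` in the `j`-th column. The vertices are the numbers in the filling (equal
numbers in different cells are the same vertex). As everywhere in Mathlib, only the nonempty faces
are listed. -/
def youngComplex (t : ℕ) (μ : YoungDiagram) : PreAbstractSimplicialComplex ℕ where
  faces := {s | s.Nonempty ∧ ∃ a : Fin (μ.rowLen 0) → ℕ,
    IsYoungSequence t μ a ∧ s ⊆ Finset.univ.image a}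
  isRelLowerSet_faces := by
    rintro s ⟨hs, a, ha, hsa⟩
    exact ⟨hs, fun u hus hu => ⟨hu, a, ha, hus.trans hsa⟩⟩

/-- The `t`-Young complex is finite. -/
theorem youngComplex_faces_finite (t : ℕ) (μ : YoungDiagram) : (youngComplex t μ).faces.Finite := by
  refine (Finset.finite_toSet
    (μ.cells.image fun c => youngEntry t μ c.1 c.2).powerset).subset ?_
  rintro s ⟨-, a, ⟨-, ha⟩, hsa⟩
  rw [Finset.mem_coe, Finset.mem_powerset]
  intro v hv
  obtain ⟨j, -, rfl⟩ := Finset.mem_image.1 (hsa hv)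
  obtain ⟨i, hi, h⟩ := ha j
  exact Finset.mem_image.2 ⟨(i, (j : ℕ)), hi, h.symm⟩

/-- The geometric realization of a finite simplicial complex: the points are given by their
barycentric coordinates, i.e. they are the convex combinations of the vertices of a face, and the
topology is the subspace topology of the product topology (which is the usual topology of the
realization, since the complex is finite). -/
def PreAbstractSimplicialComplex.realization {ι : Type*} (K : PreAbstractSimplicialComplex ι) :
    Set (ι → ℝ) :=
  {x | (∀ v, 0 ≤ x v) ∧ ∃ s ∈ K.faces, (∀ v, v ∉ s → x v = 0) ∧ ∑ v ∈ s, x v = 1}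

/-- The `n`-dimensional sphere: the unit sphere of `ℝⁿ⁺¹`. -/
abbrev UnitSphere (n : ℕ) : Type :=
  Metric.sphere (0 : EuclideanSpace ℝ (Fin (n + 1))) 1

/-- The base point `(1, 0, …, 0)` of the `n`-dimensional sphere. -/
noncomputable def UnitSphere.base (n : ℕ) : UnitSphere n :=
  ⟨EuclideanSpace.single 0 1, by simp⟩

/-- The relation on a disjoint union of pointed spaces that identifies all the base points. -/
inductive WedgeRel {ι : Type*} {X : ι → Type*} (x : ∀ i, X i) : (Σ i, X i) → (Σ i, X i) → Prop
  | base (i j : ι) : WedgeRel x ⟨i, x i⟩ ⟨j, x j⟩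

/-- The wedge sum of a nonempty family of pointed spaces `(X i, x i)`: the quotient of the disjoint
union of the `X i` that identifies all the base points, with the quotient topology. -/
abbrev WedgeSum {ι : Type*} {X : ι → Type*} (x : ∀ i, X i) : Type _ :=
  Quot (WedgeRel x)

/-- The wedge of the `k + 1` spheres of dimensions `n 0, …, n k`. -/
abbrev WedgeOfSpheres {k : ℕ} (n : Fin (k + 1) → ℕ) : Type :=
  WedgeSum fun i => UnitSphere.base (n i)

/-! ### Combinatorial collapses and cell attachments -/

section Combinatorics

variable {ι : Type*} [DecidableEq ι]

/-- The faces of the join of a complex with a vertex `b`, where a complex is given by the family of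
its faces, including the empty one. -/
def coneOver (b : ι) (A : Set (Finset ι)) : Set (Finset ι) := {s | s.erase b ∈ A}

/-- Families of faces that can be reduced to a cone by removing stars of faces whose link is a
cone. -/
inductive Collapsible : Set (Finset ι) → Prop
  | cone {K : Set (Finset ι)} (w : ι) (h0 : ∅ ∈ K) (h : ∀ s ∈ K, insert w s ∈ K) : Collapsible K
  | expand {K : Set (Finset ι)} (σ : Finset ι) (w : ι) (hσ : σ ∈ K) (hσ0 : σ.Nonempty) (hw : w ∉ σ)
      (h : ∀ s ∈ K, σ ⊆ s → insert w s ∈ K) (hK : Collapsible {s ∈ K | ¬ σ ⊆ s}) : Collapsible K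

/-- `CellularExtension v D K` says that `K` arises from `D` by adding stars of faces whose link is a
cone, by adding single faces with at least two vertices whose boundary lies in a collapsible
subcomplex, and, if `v` holds, by adding isolated vertices. -/
inductive CellularExtension (v : Prop) (D : Set (Finset ι)) : Set (Finset ι) → Prop
  | refl : CellularExtension v D D
  | vertex {K : Set (Finset ι)} (x : ι) (hv : v) (hx : ∀ s ∈ K, x ∉ s) (hK : CellularExtension v D K) :
      CellularExtension v D (insert {x} K)
  | expand {K : Set (Finset ι)} (σ : Finset ι) (w : ι) (hσ : σ ∈ K) (hσ0 : σ.Nonempty) (hw : w ∉ σ)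
      (h : ∀ s ∈ K, σ ⊆ s → insert w s ∈ K) (hK : CellularExtension v D {s ∈ K | ¬ σ ⊆ s}) :
      CellularExtension v D K
  | cell {K : Set (Finset ι)} (F : Finset ι) (C : Set (Finset ι)) (hF : F ∈ K)
      (hmax : ∀ s ∈ K, F ⊆ s → s = F) (hcard : 1 < F.card) (hCK : C ⊆ K \ {F})
      (hCl : IsLowerSet C) (hC : Collapsible C) (hFC : ∀ s, s ⊂ F → s ∈ C)
      (hK : CellularExtension v D (K \ {F})) : CellularExtension v D K

theorem CellularExtension.trans {v : Prop} {D E K : Set (Finset ι)}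
    (hDE : CellularExtension v D E) (hEK : CellularExtension v E K) :
    CellularExtension v D K := by
  induction hEK with
  | refl => exact hDE
  | vertex x hv hx _ ih => exact .vertex x hv hx ih
  | expand σ w hσ hσ0 hw h _ ih => exact .expand σ w hσ hσ0 hw h ih
  | cell F C hF hmax hcard hCK hCl hC hFC _ ih =>
    exact .cell F C hF hmax hcard hCK hCl hC hFC ih

theorem CellularExtension.empty_mem {v : Prop} {D K : Set (Finset ι)}
    (hK : CellularExtension v D K) (hD : ∅ ∈ D) : ∅ ∈ K := by
  induction hK with
  | refl => exact hD
  | vertex x hv hx _ ih => exact Set.mem_insert_of_mem _ ih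
  | expand σ w hσ hσ0 hw h _ ih => exact ih.1
  | cell F C hF hmax hcard hCK hCl hC hFC _ ih => exact ih.1

theorem IsLowerSet.coneOver {A : Set (Finset ι)} (hA : IsLowerSet A) (b : ι) :
    IsLowerSet (coneOver b A) :=
  fun _ _ hts hs => hA (Finset.erase_subset_erase b hts) hs

/-- Coning off a collapsible subcomplex of the base of a cone leaves it collapsible. -/
theorem Collapsible.coneOver_union_coneOver {A C : Set (Finset ι)} (hC : Collapsible C) {b w : ι}
    (hA : IsLowerSet A) (hA0 : ∅ ∈ A) (hbA : ∀ s ∈ A, b ∉ s) (hCA : C ⊆ A) (hwb : w ≠ b) :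
    Collapsible (coneOver w A ∪ coneOver b C) := by
  have key : ∀ s ∈ coneOver w A ∪ coneOver b C, b ∈ s → s.erase b ∈ C := by
    rintro s (hs | hs) hbs
    · exact absurd (Finset.mem_erase.2 ⟨hwb.symm, hbs⟩) (hbA _ hs)
    · exact hs
  have low : ∀ s ∈ coneOver w A ∪ coneOver b C, b ∉ s → s ∈ coneOver w A := by
    rintro s (hs | hs) hbs
    · exact hs
    · have : s ∈ C := by simpa [coneOver, Finset.erase_eq_of_notMem hbs] using hs
      exact hA (Finset.erase_subset w s) (hCA this)
  induction hC with
  | @cone C w₀ h0 h =>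
    have hw₀ : b ≠ w₀ := by
      rintro rfl
      exact hbA _ (hCA (h _ h0)) (Finset.mem_insert_self _ _)
    -- The link of b is the cone C itself, so b can be removed; the cone with apex w over A remains.
    refine .expand {b} w₀ (Or.inr ?_) (Finset.singleton_nonempty b) (by simpa using hw₀.symm)
      (fun s hs hbs => Or.inr ?_) ?_
    · simpa [coneOver] using h0
    · have := h _ (key s hs (by simpa using hbs))
      rwa [← Finset.erase_insert_of_ne hw₀.symm] at this
    · have : {s ∈ coneOver w A ∪ coneOver b C | ¬ {b} ⊆ s} = coneOver w A := by
        ext s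
        simp only [Finset.singleton_subset_iff, Set.mem_ofPred_eq]
        refine ⟨fun hs => low s hs.1 hs.2, fun hs => ⟨Or.inl hs, fun hbs => ?_⟩⟩
        exact hbA _ hs (Finset.mem_erase.2 ⟨hwb.symm, hbs⟩)
      rw [this]
      refine .cone w (by simpa [coneOver] using hA0) fun s hs => ?_
      simpa [coneOver, Finset.erase_insert_eq_erase] using hs
  | @expand C σ w₀ hσ hσ0 hw h hC ih =>
    have hbσ := hbA _ (hCA hσ)
    have hw₀ : b ≠ w₀ := by
      rintro rfl
      exact hbA _ (hCA (h _ hσ subset_rfl)) (Finset.mem_insert_self _ _)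
    -- The link of σ ∪ {b} is the link of σ in C, so each removal in C lifts to one in the cone over
    -- C.
    refine .expand (insert b σ) w₀ (Or.inr ?_) (Finset.insert_nonempty _ _)
      (by simp [hw, hw₀.symm]) (fun s hs hbs => Or.inr ?_) ?_
    · simpa [coneOver, Finset.erase_insert hbσ] using hσ
    · have hb := hbs (Finset.mem_insert_self _ _)
      have := h _ (key s hs hb) (Finset.subset_erase.2
        ⟨(Finset.subset_insert _ _).trans hbs, hbσ⟩)
      rwa [← Finset.erase_insert_of_ne hw₀.symm] at this
    · have : {s ∈ coneOver w A ∪ coneOver b C | ¬ insert b σ ⊆ s} =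
          coneOver w A ∪ coneOver b {s ∈ C | ¬ σ ⊆ s} := by
        ext s
        constructor
        · rintro ⟨hs, hsb⟩
          by_cases hb : b ∈ s
          · refine Or.inr ⟨key s hs hb, fun h' => hsb ?_⟩
            exact Finset.insert_subset hb (h'.trans (Finset.erase_subset _ _))
          · exact Or.inl (low s hs hb)
        · rintro (hs | hs)
          · refine ⟨Or.inl hs, fun h' => ?_⟩
            exact hbA _ hs (Finset.mem_erase.2 ⟨hwb.symm, h' (Finset.mem_insert_self _ _)⟩)
          · refine ⟨Or.inr hs.1, fun h' => hs.2 ?_⟩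
            exact Finset.subset_erase.2 ⟨(Finset.subset_insert _ _).trans h', hbσ⟩
      rw [this]
      refine ih (fun s hs => hCA hs.1) ?_ ?_
      · exact fun s hs hb => by
          rcases hs with hs | hs
          · exact absurd (Finset.mem_erase.2 ⟨hwb.symm, hb⟩) (hbA _ hs)
          · exact hs
      · exact fun s hs hb => low s (hs.imp_right fun h' => h'.1) hb

/-- If `A` is built from cells, then attaching the cone over `A` to a complex in which `A` is
contained in a cone amounts to attaching cells along contractible boundaries. -/
theorem CellularExtension.union_coneOver {v : Prop} {A A' D : Set (Finset ι)} {b w : ι}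
    (hA : CellularExtension True {∅} A) (hAl : IsLowerSet A) (hAA' : A ⊆ A') (hA' : IsLowerSet A')
    (hA'D : A' ⊆ D) (hD : IsLowerSet D) (hwD : ∀ s ∈ A', insert w s ∈ D) (hb : ∀ s ∈ D, b ∉ s) :
    A = {∅} ∨ CellularExtension v D (D ∪ coneOver b A) := by
  have hwb : ∅ ∈ A' → w ≠ b := by
    rintro h0 rfl
    exact hb _ (hwD _ h0) (Finset.mem_insert_self _ _)
  have hwA : coneOver w A' ⊆ D := fun s hs =>
    hD (Finset.insert_erase_subset w s) (hwD _ hs)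
  have key : ∀ {B : Set (Finset ι)} {s}, s ∈ D ∪ coneOver b B → b ∈ s → s.erase b ∈ B := by
    rintro B s (hs | hs) hbs
    · exact absurd hbs (hb _ hs)
    · exact hs
  have low : ∀ {B : Set (Finset ι)} {s}, B ⊆ A' → s ∈ D ∪ coneOver b B → b ∉ s → s ∈ D := by
    rintro B s hBA (hs | hs) hbs
    · exact hs
    · exact hA'D (hBA (by simpa [coneOver, Finset.erase_eq_of_notMem hbs] using hs))
  have remove : ∀ {B : Set (Finset ι)} {F}, F ∈ B → B ⊆ A' →
      (D ∪ coneOver b B) \ {insert b F} = D ∪ coneOver b (B \ {F}) := by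
    intro B F hF hB
    have hbF : b ∉ F := hb _ (hA'D (hB hF))
    ext s
    constructor
    · rintro ⟨hs, hsF⟩
      by_cases hbs : b ∈ s
      · refine Or.inr ⟨key hs hbs, fun h' => hsF ?_⟩
        rw [Set.mem_singleton_iff] at h' ⊢
        rw [← h', Finset.insert_erase hbs]
      · exact Or.inl (low hB hs hbs)
    · rintro (hs | hs)
      · refine ⟨Or.inl hs, ?_⟩
        rintro rfl
        exact hb _ hs (Finset.mem_insert_self _ _)
      · refine ⟨Or.inr hs.1, ?_⟩
        rintro rfl
        exact hs.2 (by simp [Finset.erase_insert hbF])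
  have attach : ∀ {B C : Set (Finset ι)} {F}, F ∈ B → B ⊆ A' → F.Nonempty →
      (∀ s ∈ B, F ⊆ s → s = F) → C ⊆ B \ {F} → IsLowerSet C → Collapsible C →
      (∀ s, s ⊂ F → s ∈ C) → CellularExtension v D (D ∪ coneOver b (B \ {F})) →
      CellularExtension v D (D ∪ coneOver b B) := by
    intro B C F hF hB hF0 hmax hCB hCl hC hFC hext
    have hbF : b ∉ F := hb _ (hA'D (hB hF))
    have hFA : F ∈ A' := hB hF
    have h0 : ∅ ∈ A' := hA' (Finset.empty_subset F) hFA
    -- Proper faces of F ∪ {b} that contain b come from proper faces of F, hence from C; the others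
    -- are faces of F, hence lie in A'. Both parts are in the stated collapsible complex.
    refine .cell (insert b F) (coneOver w A' ∪ coneOver b C) (Or.inr ?_) ?_ ?_ ?_ ?_ ?_ ?_ ?_
    · simpa [coneOver, Finset.erase_insert hbF] using hF
    · intro s hs hFs
      have hbs := hFs (Finset.mem_insert_self _ _)
      have := hmax _ (key hs hbs) (Finset.subset_erase.2
        ⟨(Finset.subset_insert _ _).trans hFs, hbF⟩)
      rw [← this, Finset.insert_erase hbs]
    · rw [Finset.card_insert_of_notMem hbF]
      have := hF0.card_pos
      omega
    · rw [remove hF hB]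
      exact Set.union_subset_union hwA fun s hs => hCB hs
    · exact (hA'.coneOver w).union (hCl.coneOver b)
    · exact hC.coneOver_union_coneOver hA' h0 (fun s hs => hb s (hA'D hs))
        (fun s hs => hB (hCB hs).1) (hwb h0)
    · intro s hs
      by_cases hbs : b ∈ s
      · refine Or.inr (hFC _ ?_)
        refine ⟨fun x hx => ?_, fun h' => hs.2 ?_⟩
        · obtain ⟨hxb, hxs⟩ := Finset.mem_erase.1 hx
          exact (Finset.mem_insert.1 (hs.1 hxs)).resolve_left hxb
        · exact Finset.insert_subset hbs (h'.trans (Finset.erase_subset _ _))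
      · refine Or.inl (hA' ((Finset.erase_subset _ _).trans fun x hx => ?_) hFA)
        refine (Finset.mem_insert.1 (hs.1 hx)).resolve_left ?_
        rintro rfl
        exact hbs hx
    · rw [remove hF hB]
      exact hext
  -- Only A shrinks; A' and D stay fixed, so the cone with apex w over the whole of A' is available
  -- at every stage.
  induction hA with
  | refl => exact Or.inl rfl
  | @vertex Y x _ hx hY ih =>
    right
    have hYl : IsLowerSet Y := by
      intro s r hrs hs
      rcases hAl hrs (Set.mem_insert_of_mem _ hs) with h' | h'
      · subst h'
        exact absurd (hrs (Finset.mem_singleton_self x)) (hx s hs)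
      · exact h'
    have h0 : ∅ ∈ Y := hY.empty_mem rfl
    have hxY : {x} ∉ Y := fun h => hx _ h (Finset.mem_singleton_self x)
    have hdiff : insert {x} Y \ {{x}} = Y := by
      ext s
      simp only [Set.mem_sdiff, Set.mem_insert_iff, Set.mem_singleton_iff]
      refine ⟨fun h => h.1.resolve_left h.2, fun h => ⟨Or.inr h, ?_⟩⟩
      rintro rfl
      exact hxY h
    rcases eq_or_ne Y {∅} with rfl | hY'
    · refine .expand {b} x (Or.inr ?_) (Finset.singleton_nonempty b) ?_ (fun s hs hbs => Or.inr ?_) ?_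
      · simp [coneOver]
      · have : b ∉ ({x} : Finset ι) := hb _ (hA'D (hAA' (Set.mem_insert _ _)))
        simpa [eq_comm] using this
      · have hbx : b ∉ ({x} : Finset ι) := hb _ (hA'D (hAA' (Set.mem_insert _ _)))
        have := key hs (by simpa using hbs)
        have hbx' : x ≠ b := by simpa [eq_comm] using hbx
        rw [coneOver, Set.mem_ofPred_eq, Finset.erase_insert_of_ne hbx']
        rcases this with h | h
        · rw [h]; simp
        · rw [h]; simp
      · have : {s ∈ D ∪ coneOver b (insert {x} {∅}) | ¬ {b} ⊆ s} = D := by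
          ext s
          simp only [Finset.singleton_subset_iff, Set.mem_ofPred_eq]
          exact ⟨fun hs => low hAA' hs.1 hs.2, fun hs => ⟨Or.inl hs, hb s hs⟩⟩
        rw [this]
        exact .refl
    · have hext := (ih hYl ((Set.subset_insert _ _).trans hAA')).resolve_left hY'
      -- Any further vertex x adds the edge {b, x} as a 1-cell. Its end b is joined to the cone with
      -- apex w through an older vertex y, so both ends lie in a collapsible subcomplex.
      obtain ⟨y, hy⟩ : ∃ y, {y} ∈ Y := by
        by_contra! h
        refine hY' (Set.eq_singleton_iff_unique_mem.2 ⟨h0, fun s hs => ?_⟩)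
        by_contra hs0
        obtain ⟨y, hy⟩ := Finset.nonempty_iff_ne_empty.2 hs0
        exact h y (hYl (Finset.singleton_subset_iff.2 hy) hs)
      · refine attach (C := {∅, {y}}) (Set.mem_insert _ _) hAA' (Finset.singleton_nonempty x)
          ?_ ?_ ?_ ?_ ?_ (by rwa [hdiff])
        · rintro s (hs | hs) hxs
          · exact hs
          · exact absurd (hxs (Finset.mem_singleton_self x)) (hx s hs)
        · rw [hdiff]
          rintro s (rfl | rfl)
          · exact h0
          · exact hy
        · rintro s r hrs (rfl | rfl)
          · exact Or.inl (Finset.subset_empty.1 hrs)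
          · exact Finset.subset_singleton_iff.1 hrs
        · refine .cone y (Or.inl rfl) ?_
          rintro s (rfl | rfl) <;> simp
        · intro s hs
          exact Or.inl (Finset.ssubset_singleton_iff.1 hs)
  | @expand K σ w₀ hσ hσ0 hw h hK ih =>
    right
    have hbσ : b ∉ σ := hb _ (hA'D (hAA' hσ))
    have hbw : w₀ ≠ b := by
      rintro rfl
      exact hb _ (hA'D (hAA' (h _ hσ subset_rfl))) (Finset.mem_insert_self _ _)
    have hKl : IsLowerSet {s ∈ K | ¬ σ ⊆ s} :=
      fun s r hrs hs => ⟨hAl hrs hs.1, fun h' => hs.2 (h'.trans hrs)⟩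
    rcases ih hKl (fun s hs => hAA' hs.1) with h' | hext
    · have hmem : {w₀} ∈ {s ∈ K | ¬ σ ⊆ s} := by
        refine ⟨hAl (by simp) (h _ hσ subset_rfl), fun hσw => ?_⟩
        obtain ⟨x, hx⟩ := hσ0
        have := Finset.mem_singleton.1 (hσw hx)
        exact hw (this ▸ hx)
      rw [h'] at hmem
      simp at hmem
    · refine .expand (insert b σ) w₀ (Or.inr ?_) (Finset.insert_nonempty _ _)
        (by simp [hw, hbw]) (fun s hs hbs => Or.inr ?_) ?_
      · simpa [coneOver, Finset.erase_insert hbσ] using hσ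
      · have := h _ (key hs (hbs (Finset.mem_insert_self _ _))) (Finset.subset_erase.2
          ⟨(Finset.subset_insert _ _).trans hbs, hbσ⟩)
        rwa [← Finset.erase_insert_of_ne hbw] at this
      · have : {s ∈ D ∪ coneOver b K | ¬ insert b σ ⊆ s} =
            D ∪ coneOver b {s ∈ K | ¬ σ ⊆ s} := by
          ext s
          constructor
          · rintro ⟨hs, hsb⟩
            by_cases hbs : b ∈ s
            · refine Or.inr ⟨key hs hbs, fun h' => hsb ?_⟩
              exact Finset.insert_subset hbs (h'.trans (Finset.erase_subset _ _))
            · exact Or.inl (low hAA' hs hbs)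
          · rintro (hs | hs)
            · exact ⟨Or.inl hs, fun h' => hb _ hs (h' (Finset.mem_insert_self _ _))⟩
            · exact ⟨Or.inr hs.1, fun h' => hs.2 (Finset.subset_erase.2
                ⟨(Finset.subset_insert _ _).trans h', hbσ⟩)⟩
        rw [this]
        exact hext
  | @cell K F C hF hmax hcard hCK hCl hC hFC hK ih =>
    right
    have hKl : IsLowerSet (K \ {F}) := by
      intro s r hrs hs
      refine ⟨hAl hrs hs.1, ?_⟩
      rintro rfl
      exact hs.2 (hmax s hs.1 hrs)
    have hF0 : F.Nonempty := Finset.card_pos.1 (by omega)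
    refine attach hF hAA' hF0 hmax hCK hCl hC hFC ?_
    refine (ih hKl (Set.sdiff_subset.trans hAA')).resolve_left fun h' => ?_
    obtain ⟨x, hx⟩ := hF0
    have hmem : {x} ∈ K \ {F} := by
      refine ⟨hAl (Finset.singleton_subset_iff.2 hx) hF, ?_⟩
      rintro h
      rw [← Set.mem_singleton_iff.1 h] at hcard
      simp at hcard
    rw [h'] at hmem
    simp at hmem

end Combinatorics

/-! ### Threshold complexes and their recursion -/

section States

/-- Sets `s` of integers in `[b, V]` for which there are values `m x`, `x ∈ s`, admissible with
respect to `G`, that grow from `x` to `y` by at most `(y - x - 1) / t`, where a virtual element `a`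
has value `c`. -/
def thresholdFaces (t V : ℕ) (G : ℕ → ℕ → Prop) (a b c : ℕ) : Set (Finset ℕ) :=
  {s | ∃ m : ℕ → ℕ,
    (∀ x ∈ s, b ≤ x ∧ x ≤ V ∧ G x (m x) ∧ m x ≤ c + (x - a - 1) / t) ∧
      ∀ x ∈ s, ∀ y ∈ s, x < y → m y ≤ m x + (y - x - 1) / t}

/-- The admissible values form an up-set, which shrinks with the point, and shifting the point by
`t` costs at most one. -/
structure IsThreshold (t : ℕ) (G : ℕ → ℕ → Prop) : Prop where
  mono : ∀ {x m m'}, G x m → m ≤ m' → G x m'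
  anti : ∀ {x y m}, G y m → x ≤ y → G x m
  shift : ∀ {x m}, G x m → G (x + t) (m + 1)

variable {t V : ℕ} {G : ℕ → ℕ → Prop} {a b c : ℕ}

theorem isLowerSet_thresholdFaces : IsLowerSet (thresholdFaces t V G a b c) := by
  rintro s r hrs ⟨m, h1, h2⟩
  exact ⟨m, fun x hx => h1 x (hrs hx), fun x hx y hy => h2 x (hrs hx) y (hrs hy)⟩

theorem empty_mem_thresholdFaces : ∅ ∈ thresholdFaces t V G a b c := ⟨0, by simp⟩

theorem thresholdFaces_of_lt (h : V < b) : thresholdFaces t V G a b c = {∅} := by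
  refine Set.eq_singleton_iff_unique_mem.2 ⟨empty_mem_thresholdFaces, ?_⟩
  rintro s ⟨m, h1, -⟩
  refine Finset.eq_empty_of_forall_notMem fun x hx => ?_
  have := h1 x hx
  omega

/-- Beyond a + t, the virtual elements (a, c) and (a + t, c + 1) impose the same bound; this lets
the state advance by one window. -/
theorem add_div_sub_sub_one (ht : 0 < t) {x : ℕ} (hx : a + t < x) :
    (x - a - 1) / t = (x - (a + t) - 1) / t + 1 := by
  rw [← Nat.add_div_right _ ht]
  congr 1
  omega

theorem div_sub_sub_one_eq_zero {x : ℕ} (hx : a < x) (hx' : x ≤ a + t) : (x - a - 1) / t = 0 :=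
  Nat.div_eq_of_lt (by omega)

/-- If the first point is not a vertex, then neither is any other point of the first window. -/
theorem thresholdFaces_of_not (hG : IsThreshold t G) (ht : 0 < t) (hab : a < b) (hba : b ≤ a + t)
    (hb : ¬ G b c) :
    thresholdFaces t V G a b c = thresholdFaces t V G (a + t) (a + t + 1) (c + 1) := by
  ext s
  constructor
  · rintro ⟨m, h1, h2⟩
    refine ⟨m, fun x hx => ?_, h2⟩
    obtain ⟨hbx, hxV, hx1, hx2⟩ := h1 x hx
    have hax : a + t < x := by
      by_contra! h
      rw [div_sub_sub_one_eq_zero (by omega) h] at hx2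
      exact hb (hG.anti (hG.mono hx1 hx2) hbx)
    rw [add_div_sub_sub_one ht hax] at hx2
    exact ⟨hax, hxV, hx1, by omega⟩
  · rintro ⟨m, h1, h2⟩
    refine ⟨m, fun x hx => ?_, h2⟩
    obtain ⟨hax, hxV, hx1, hx2⟩ := h1 x hx
    rw [add_div_sub_sub_one ht hax]
    exact ⟨by omega, hxV, hx1, by omega⟩

/-- The faces of the threshold complex that avoid the first window except for its first point. -/
theorem thresholdFaces_inter_eq (ht : 0 < t) (hab : a < b) (hba : b ≤ a + t) (hb : G b c)
    (hbV : b ≤ V) :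
    {s ∈ thresholdFaces t V G a b c | ∀ x ∈ s, x ≤ b ∨ a + t + 1 ≤ x} =
      thresholdFaces t V G (a + t) (a + t + 1) (c + 1) ∪
        coneOver b (thresholdFaces t V G b (a + t + 1) c) := by
  ext s
  constructor
  · rintro ⟨⟨m, h1, h2⟩, h3⟩
    by_cases hbs : b ∈ s
    · right
      refine ⟨m, fun x hx => ?_, fun x hx y hy =>
        h2 x (Finset.mem_of_mem_erase hx) y (Finset.mem_of_mem_erase hy)⟩
      obtain ⟨hxb, hxs⟩ := Finset.mem_erase.1 hx
      obtain ⟨hbx, hxV, hx1, hx2⟩ := h1 x hxs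
      have hax : a + t + 1 ≤ x := (h3 x hxs).resolve_left (by omega)
      refine ⟨hax, hxV, hx1, (h2 b hbs x hxs (by omega)).trans ?_⟩
      have := (h1 b hbs).2.2.2
      rw [div_sub_sub_one_eq_zero hab hba] at this
      omega
    · left
      refine ⟨m, fun x hx => ?_, h2⟩
      obtain ⟨hbx, hxV, hx1, hx2⟩ := h1 x hx
      have hxb : x ≠ b := by rintro rfl; exact hbs hx
      have hax : a + t + 1 ≤ x := (h3 x hx).resolve_left (by omega)
      rw [add_div_sub_sub_one ht hax] at hx2
      exact ⟨hax, hxV, hx1, by omega⟩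
  · rintro (⟨m, h1, h2⟩ | ⟨m, h1, h2⟩)
    · refine ⟨⟨m, fun x hx => ?_, h2⟩, fun x hx => Or.inr (h1 x hx).1⟩
      obtain ⟨hax, hxV, hx1, hx2⟩ := h1 x hx
      rw [add_div_sub_sub_one ht hax]
      exact ⟨by omega, hxV, hx1, by omega⟩
    · have h1' : ∀ x ∈ s, x ≠ b → _ := fun x hx hxb => h1 x (Finset.mem_erase.2 ⟨hxb, hx⟩)
      -- The level c is the highest one allowed at b, and the link was defined with exactly this
      -- level at the virtual element b.
      refine ⟨⟨Function.update m b c, fun x hx => ?_, fun x hx y hy hxy => ?_⟩, fun x hx => ?_⟩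
      · rcases eq_or_ne x b with rfl | hxb
        · simp [hb, hbV]
        · obtain ⟨hax, hxV, hx1, hx2⟩ := h1' x hx hxb
          rw [Function.update_of_ne hxb]
          refine ⟨by omega, hxV, hx1, hx2.trans ?_⟩
          gcongr
      · have hyb : y ≠ b := by
          rintro rfl
          rcases eq_or_ne x y with rfl | hxb
          · omega
          · have := (h1' x hx hxb).1
            omega
        rw [Function.update_of_ne hyb]
        rcases eq_or_ne x b with rfl | hxb
        · rw [Function.update_self]
          exact (h1' y hy hyb).2.2.2
        · rw [Function.update_of_ne hxb]
          exact h2 x (Finset.mem_erase.2 ⟨hxb, hx⟩) y (Finset.mem_erase.2 ⟨hyb, hy⟩) hxy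
      · rcases eq_or_ne x b with rfl | hxb
        · exact Or.inl le_rfl
        · exact Or.inr (h1' x hx hxb).1

/-- The points of the first window are dominated by its first point. -/
theorem insert_mem_thresholdFaces (hG : IsThreshold t G) (hab : a < b) {j : ℕ} (hbj : b < j)
    (hja : j ≤ a + t) {s : Finset ℕ} (hs : s ∈ thresholdFaces t V G a b c) (hj : j ∈ s) :
    insert b s ∈ thresholdFaces t V G a b c := by
  by_cases hbs : b ∈ s
  · rwa [Finset.insert_eq_of_mem hbs]
  obtain ⟨m, h1, h2⟩ := hs
  obtain ⟨-, hjV, hj1, hj2⟩ := h1 j hj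
  rw [div_sub_sub_one_eq_zero (by omega) hja] at hj2
  have hne : ∀ x ∈ s, x ≠ b := by rintro x hx rfl; exact hbs hx
  -- Giving b its highest level c makes it least restrictive. Points before j lie in the window and
  -- have level at most c; points after j are already bounded through j, which is later than b and
  -- has level at most c.
  refine ⟨Function.update m b c, fun x hx => ?_, fun x hx y hy hxy => ?_⟩
  · rcases Finset.mem_insert.1 hx with rfl | hx
    · simp only [Function.update_self, le_refl, true_and]
      exact ⟨by omega, hG.anti (hG.mono hj1 hj2) hbj.le, Nat.le_add_right _ _⟩
    · rw [Function.update_of_ne (hne x hx)]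
      exact h1 x hx
  · rcases Finset.mem_insert.1 hy with rfl | hys
    · rcases Finset.mem_insert.1 hx with rfl | hx
      · omega
      · have := (h1 x hx).1
        omega
    rw [Function.update_of_ne (hne y hys)]
    rcases Finset.mem_insert.1 hx with rfl | hx
    · rw [Function.update_self]
      rcases lt_trichotomy y j with hyj | rfl | hyj
      · have := (h1 y hys).2.2.2
        rw [div_sub_sub_one_eq_zero (by omega) (by omega)] at this
        exact this.trans (Nat.le_add_right _ _)
      · exact hj2.trans (Nat.le_add_right _ _)
      · refine (h2 j hj y hys hyj).trans (Nat.add_le_add (by omega) ?_)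
        gcongr
    · rw [Function.update_of_ne (hne x hx)]
      exact h2 x hx y hys hxy

/-- The first point after the first window dominates the link of the first point. -/
theorem insert_mem_thresholdFaces_link (hG : IsThreshold t G) (ht : 0 < t) (hab : a < b)
    (hb : G b c) (hV : a + t + 1 ≤ V) {s : Finset ℕ}
    (hs : s ∈ thresholdFaces t V G b (a + t + 1) c) :
    insert (a + t + 1) s ∈ thresholdFaces t V G (a + t) (a + t + 1) (c + 1) := by
  obtain ⟨m, h1, h2⟩ := hs
  set w := a + t + 1 with hw
  -- Admissibility of (b, c) shifts to (b + t, c + 1), and w ≤ b + t because a < b.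
  have hGw : G w (c + 1) := hG.anti (hG.shift hb) (by omega)
  by_cases hws : w ∈ s
  · rw [Finset.insert_eq_of_mem hws]
    refine ⟨m, fun x hx => ?_, h2⟩
    obtain ⟨hwx, hxV, hx1, hx2⟩ := h1 x hx
    refine ⟨hwx, hxV, hx1, hx2.trans ?_⟩
    rw [add_assoc, add_comm 1, ← add_div_sub_sub_one ht (by omega)]
    gcongr
  have hne : ∀ x ∈ s, x ≠ w := by rintro x hx rfl; exact hws hx
  refine ⟨Function.update m w (c + 1), fun x hx => ?_, fun x hx y hy hxy => ?_⟩
  · rcases Finset.mem_insert.1 hx with rfl | hx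
    · simp [hGw, hV]
    · rw [Function.update_of_ne (hne x hx)]
      obtain ⟨hwx, hxV, hx1, hx2⟩ := h1 x hx
      refine ⟨hwx, hxV, hx1, hx2.trans ?_⟩
      rw [add_assoc, add_comm 1, ← add_div_sub_sub_one ht (by omega)]
      gcongr
  · rcases Finset.mem_insert.1 hy with rfl | hys
    · rcases Finset.mem_insert.1 hx with rfl | hx
      · omega
      · have := (h1 x hx).1
        omega
    rw [Function.update_of_ne (hne y hys)]
    rcases Finset.mem_insert.1 hx with rfl | hx
    · rw [Function.update_self]
      refine (h1 y hys).2.2.2.trans ?_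
      rw [add_assoc, add_comm 1, ← Nat.add_div_right _ ht]
      gcongr
      omega
    · rw [Function.update_of_ne (hne x hx)]
      exact h2 x hx y hys hxy

/-- A later virtual element of the same level is more restrictive: (x - b - 1) / t ≤ (x - a - 1) / t
since a < b. -/
theorem thresholdFaces_link_subset (ht : 0 < t) (hab : a < b) :
    thresholdFaces t V G b (a + t + 1) c ⊆
      thresholdFaces t V G (a + t) (a + t + 1) (c + 1) := by
  rintro s ⟨m, h1, h2⟩
  refine ⟨m, fun x hx => ?_, h2⟩
  obtain ⟨hwx, hxV, hx1, hx2⟩ := h1 x hx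
  refine ⟨hwx, hxV, hx1, hx2.trans ?_⟩
  rw [add_assoc, add_comm 1, ← add_div_sub_sub_one ht (by omega)]
  gcongr

/-- The threshold complex reduces to the faces that avoid the first window except for its first
point. -/
theorem CellularExtension.thresholdFaces {v : Prop} {E : Set (Finset ℕ)} (hG : IsThreshold t G)
    (ht : 0 < t) (hab : a < b) (hba : b ≤ a + t) (hb : G b c) (hbV : b ≤ V)
    (hE : CellularExtension v E (thresholdFaces t V G (a + t) (a + t + 1) (c + 1) ∪
      coneOver b (thresholdFaces t V G b (a + t + 1) c))) :
    CellularExtension v E (thresholdFaces t V G a b c) := by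
  rw [← thresholdFaces_inter_eq ht hab hba hb hbV] at hE
  -- The complex at j has already lost the points strictly between b and j. The descending induction
  -- puts them back one at a time, each dominated by b.
  have key : ∀ j, b + 1 ≤ j → j ≤ a + t + 1 → CellularExtension v E
      {s ∈ _root_.thresholdFaces t V G a b c | ∀ x ∈ s, x ≤ b ∨ j ≤ x} := by
    intro j hbj hj
    induction hj using Nat.decreasingInduction with
    | self => exact hE
    | of_succ j hj ih =>
      have ih := ih (by omega)
      have heq : {s ∈ {s ∈ _root_.thresholdFaces t V G a b c | ∀ x ∈ s, x ≤ b ∨ j ≤ x} |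
          ¬ {j} ⊆ s} = {s ∈ _root_.thresholdFaces t V G a b c | ∀ x ∈ s, x ≤ b ∨ j + 1 ≤ x} := by
        ext s
        simp only [Finset.singleton_subset_iff, Set.mem_ofPred_eq]
        constructor
        · rintro ⟨⟨hs, h⟩, hjs⟩
          refine ⟨hs, fun x hx => ?_⟩
          have : x ≠ j := by rintro rfl; exact hjs hx
          have := h x hx
          omega
        · rintro ⟨hs, h⟩
          refine ⟨⟨hs, fun x hx => ?_⟩, fun hjs => ?_⟩
          · have := h x hx
            omega
          · have := h j hjs
            omega
      by_cases hjK : {j} ∈ {s ∈ _root_.thresholdFaces t V G a b c | ∀ x ∈ s, x ≤ b ∨ j ≤ x}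
      · refine .expand {j} b hjK (Finset.singleton_nonempty j) (by simp; omega) ?_
          (by rwa [heq])
        rintro s ⟨hs, h⟩ hjs
        refine ⟨insert_mem_thresholdFaces hG hab (j := j) (by omega) (by omega) hs (by simpa using hjs), ?_⟩
        intro x hx
        rcases Finset.mem_insert.1 hx with rfl | hx
        · exact Or.inl le_rfl
        · exact h x hx
      · rw [← heq] at ih
        convert ih using 1
        ext s
        refine ⟨fun hs => ⟨hs, fun hjs => hjK ?_⟩, fun hs => hs.1⟩
        exact ⟨isLowerSet_thresholdFaces hjs hs.1, fun x hx => hs.2 x (hjs hx)⟩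
  convert key (b + 1) le_rfl (by omega) using 1
  ext s
  refine ⟨fun hs => ⟨hs, fun x _ => ?_⟩, fun hs => hs.1⟩
  omega

theorem coneOver_singleton_empty (b : ℕ) : coneOver b {∅} = {∅, {b}} := by
  ext s
  simp [coneOver, Finset.erase_eq_empty_iff]

/-- Threshold complexes are built from cells and isolated vertices. -/
theorem cellularExtension_thresholdFaces (hG : IsThreshold t G) (ht : 0 < t) (hab : a < b)
    (hba : b ≤ a + t) : CellularExtension True {∅} (thresholdFaces t V G a b c) := by
  induction h : V + 1 - b using Nat.strong_induction_on generalizing a b c with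
  | _ N ih =>
    rcases lt_or_ge V b with hVb | hVb
    · rw [thresholdFaces_of_lt hVb]
      exact .refl
    have ihD := ih (V + 1 - (a + t + 1)) (by omega) (a := a + t) (b := a + t + 1) (c := c + 1)
      (by omega) (by omega) rfl
    by_cases hb : G b c
    swap
    · rwa [thresholdFaces_of_not hG ht hab hba hb]
    have ihA := ih (V + 1 - (a + t + 1)) (by omega) (a := b) (b := a + t + 1) (c := c)
      (by omega) (by omega) rfl
    refine .thresholdFaces hG ht hab hba hb hVb ?_
    have hbD : ∀ s ∈ thresholdFaces t V G (a + t) (a + t + 1) (c + 1), b ∉ s := by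
      rintro s ⟨m, h1, -⟩ hbs
      have := h1 b hbs
      omega
    have hempty : thresholdFaces t V G b (a + t + 1) c = {∅} → CellularExtension True {∅}
        (thresholdFaces t V G (a + t) (a + t + 1) (c + 1) ∪
          coneOver b (thresholdFaces t V G b (a + t + 1) c)) := by
      intro hA
      have : thresholdFaces t V G (a + t) (a + t + 1) (c + 1) ∪
          coneOver b (thresholdFaces t V G b (a + t + 1) c) =
          insert {b} (thresholdFaces t V G (a + t) (a + t + 1) (c + 1)) := by
        rw [hA, coneOver_singleton_empty, Set.union_insert, Set.union_singleton,
          Set.insert_comm, Set.insert_eq_of_mem empty_mem_thresholdFaces]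
      rw [this]
      exact .vertex b trivial hbD ihD
    rcases lt_or_ge V (a + t + 1) with hV | hV
    · exact hempty (thresholdFaces_of_lt hV)
    · rcases CellularExtension.union_coneOver (v := True) ihA isLowerSet_thresholdFaces subset_rfl
        isLowerSet_thresholdFaces (thresholdFaces_link_subset ht hab) isLowerSet_thresholdFaces
        (fun s hs => insert_mem_thresholdFaces_link hG ht hab hb hV hs) hbD with hA | hA
      · exact hempty hA
      · exact ihD.trans hA

/-- A threshold complex is built from a vertex by attaching cells of positive dimension, if in each
residue step the first point has a neighbour. -/
theorem cellularExtension_thresholdFaces_of_link_ne (hG : IsThreshold t G) (ht : 0 < t)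
    (h0 : ∀ k, k * t + 1 ≤ V → G (k * t + 1) k)
    (hlink : ∀ k, (k + 1) * t + 1 ≤ V →
      thresholdFaces t V G (k * t + 1) ((k + 1) * t + 1) k ≠ {∅}) (k : ℕ) (hk : k * t + 1 ≤ V) :
    ∃ p, CellularExtension False {∅, {p}} (thresholdFaces t V G (k * t) (k * t + 1) k) := by
  induction h : V + 1 - k * t using Nat.strong_induction_on generalizing k with
  | _ N ih =>
    have hkt : (k + 1) * t = k * t + t := by ring
    rcases lt_or_ge V ((k + 1) * t + 1) with hV | hV
    -- In the last window nothing lies beyond it, so only the vertex kt + 1 survives; it is the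
    -- starting vertex p.
    · refine ⟨k * t + 1, .thresholdFaces hG ht (by omega) (by omega) (h0 k hk) hk ?_⟩
      rw [hkt] at hV
      rw [thresholdFaces_of_lt hV, thresholdFaces_of_lt hV, coneOver_singleton_empty]
      rw [Set.union_eq_right.2 (by simp)]
      exact .refl
    · obtain ⟨p, hp⟩ := ih (V + 1 - (k + 1) * t) (by omega) (k + 1) hV rfl
      refine ⟨p, .thresholdFaces hG ht (by omega) (by omega) (h0 k hk) hk ?_⟩
      have hl := hlink k hV
      rw [hkt] at hp hl hV
      refine hp.trans (Or.resolve_left ?_ hl)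
      refine CellularExtension.union_coneOver (cellularExtension_thresholdFaces hG ht (by omega)
        (by omega)) isLowerSet_thresholdFaces subset_rfl isLowerSet_thresholdFaces
        (thresholdFaces_link_subset ht (by omega)) isLowerSet_thresholdFaces
        (fun s hs => insert_mem_thresholdFaces_link hG ht (by omega) (h0 k hk) hV hs) ?_
      rintro s ⟨m, h1, -⟩ hbs
      have := h1 _ hbs
      omega

end States

/-! ### Realizations and the homotopy effect of a collapse -/

section Realization

variable {ι : Type*}

/-- The geometric realization of a family of finite sets. -/
def simplexUnion (K : Set (Finset ι)) : Set (ι → ℝ) :=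
  {x | (∀ v, 0 ≤ x v) ∧ ∃ s ∈ K, (∀ v, v ∉ s → x v = 0) ∧ ∑ v ∈ s, x v = 1}

theorem simplexUnion_mono {K L : Set (Finset ι)} (h : K ⊆ L) : simplexUnion K ⊆ simplexUnion L :=
  fun _ ⟨h0, s, hs, h1⟩ => ⟨h0, s, h hs, h1⟩

theorem sum_eq_one_of_mem_simplexUnion {K : Set (Finset ι)} {x : ι → ℝ}
    (hx : x ∈ simplexUnion K) {s : Finset ι} (hs : ∀ v, v ∉ s → x v = 0) : ∑ v ∈ s, x v = 1 := by
  classical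
  obtain ⟨-, r, -, hr, h1⟩ := hx
  rw [← h1, Finset.sum_subset (Finset.subset_union_left (s₂ := r)) fun v _ hv => hs v hv,
    ← Finset.sum_subset (Finset.subset_union_right (s₁ := s)) fun v _ hv => hr v hv]

theorem exists_support_of_mem_simplexUnion {K : Set (Finset ι)} (hK : IsLowerSet K) {x : ι → ℝ}
    (hx : x ∈ simplexUnion K) :
    ∃ s ∈ K, (∀ v, v ∈ s ↔ 0 < x v) ∧ (∀ v, v ∉ s → x v = 0) ∧ ∑ v ∈ s, x v = 1 := by
  obtain ⟨h0, r, hr, hr0, h1⟩ := hx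
  have hv0 : ∀ v, v ∉ r.filter (0 < x ·) → x v = 0 := by
    intro v hv
    by_cases hvr : v ∈ r
    · have : ¬ 0 < x v := fun h => hv (Finset.mem_filter.2 ⟨hvr, h⟩)
      exact le_antisymm (not_lt.1 this) (h0 v)
    · exact hr0 v hvr
  refine ⟨r.filter (0 < x ·), hK (Finset.filter_subset _ _) hr, fun v => ?_, hv0, ?_⟩
  · refine ⟨fun hv => (Finset.mem_filter.1 hv).2, fun hv => ?_⟩
    by_contra h
    exact hv.ne' (hv0 v h)
  · exact sum_eq_one_of_mem_simplexUnion ⟨h0, r, hr, hr0, h1⟩ hv0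

/-- Two maps into a realization are homotopic if their values at each point lie in a common
simplex. -/
theorem homotopic_of_common_simplex {X : Type*} [TopologicalSpace X] {K : Set (Finset ι)}
    (f g : C(X, simplexUnion K))
    (h : ∀ x, ∃ s ∈ K, (∀ v, v ∉ s → (f x : ι → ℝ) v = 0) ∧ ∀ v, v ∉ s → (g x : ι → ℝ) v = 0) :
    f.Homotopic g := by
  refine ⟨⟨⟨fun p => ⟨fun v => (1 - (p.1 : ℝ)) * (f p.2 : ι → ℝ) v + p.1 * (g p.2 : ι → ℝ) v, ?_⟩,
    ?_⟩, fun x => ?_, fun x => ?_⟩⟩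
  · obtain ⟨s, hs, hf, hg⟩ := h p.2
    refine ⟨fun v => ?_, s, hs, fun v hv => ?_, ?_⟩
    · have h1 := (f p.2).2.1 v
      have h2 := (g p.2).2.1 v
      have h3 : (0 : ℝ) ≤ 1 - p.1 := sub_nonneg.2 p.1.2.2
      have h4 := p.1.2.1
      positivity
    · simp [hf v hv, hg v hv]
    · rw [Finset.sum_add_distrib, ← Finset.mul_sum, ← Finset.mul_sum,
        sum_eq_one_of_mem_simplexUnion (f p.2).2 hf, sum_eq_one_of_mem_simplexUnion (g p.2).2 hg]
      ring
  · refine Continuous.subtype_mk (continuous_pi fun v => ?_) _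
    have h1 : Continuous fun p : unitInterval × X => (f p.2 : ι → ℝ) v :=
      (continuous_apply v).comp (continuous_subtype_val.comp (f.continuous.comp continuous_snd))
    have h2 : Continuous fun p : unitInterval × X => (g p.2 : ι → ℝ) v :=
      (continuous_apply v).comp (continuous_subtype_val.comp (g.continuous.comp continuous_snd))
    have h3 : Continuous fun p : unitInterval × X => (p.1 : ℝ) :=
      continuous_subtype_val.comp continuous_fst
    exact ((continuous_const.sub h3).mul h1).add (h3.mul h2)
  · ext v
    simp
  · ext v
    simp

variable [DecidableEq ι]

theorem single_mem_simplexUnion {K : Set (Finset ι)} {w : ι} (hw : {w} ∈ K) :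
    (Pi.single w 1 : ι → ℝ) ∈ simplexUnion K := by
  refine ⟨fun v => ?_, {w}, hw, fun v hv => ?_, by simp⟩
  · by_cases h : v = w
    · subst h; simp
    · simp [h]
  · simp [Finset.mem_singleton.not.1 hv]

/-- Cones are contractible. -/
theorem contractibleSpace_simplexUnion_cone {K : Set (Finset ι)} (w : ι) (h0 : ∅ ∈ K)
    (h : ∀ s ∈ K, insert w s ∈ K) : ContractibleSpace (simplexUnion K) := by
  have hw : {w} ∈ K := by simpa using h _ h0
  rw [contractible_iff_id_nullhomotopic]
  refine ⟨⟨_, single_mem_simplexUnion hw⟩, homotopic_of_common_simplex _ _ fun x => ?_⟩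
  obtain ⟨s, hs, hs0, -⟩ := x.2.2
  refine ⟨insert w s, h s hs, fun v hv => hs0 v fun h' => hv (Finset.mem_insert_of_mem h'), ?_⟩
  intro v hv
  have : v ≠ w := by rintro rfl; exact hv (Finset.mem_insert_self _ _)
  simp [this]

/-- The map that pushes the face `σ` towards the vertex `w`. -/
noncomputable def pushFace (σ : Finset ι) (hσ : σ.Nonempty) (w : ι) (x : ι → ℝ) : ι → ℝ :=
  fun v => x v - (if v ∈ σ then σ.inf' hσ x else 0) + if v = w then σ.card * σ.inf' hσ x else 0

theorem continuous_pushFace (σ : Finset ι) (hσ : σ.Nonempty) (w : ι) :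
    Continuous (pushFace σ hσ w) := by
  have hinf : Continuous fun x : ι → ℝ => σ.inf' hσ x :=
    Continuous.finset_inf'_apply hσ fun i _ => continuous_apply i
  refine continuous_pi fun v => ?_
  refine ((continuous_apply v).sub ?_).add ?_
  · split_ifs
    · exact hinf
    · exact continuous_const
  · split_ifs
    · exact continuous_const.mul hinf
    · exact continuous_const

theorem pushFace_eq_self {σ : Finset ι} {hσ : σ.Nonempty} {w : ι} {x : ι → ℝ}
    (hx : σ.inf' hσ x = 0) : pushFace σ hσ w x = x := by
  ext v
  simp [pushFace, hx]

/-- If the minimum over σ is positive, it becomes zero where it is attained, so the image leaves the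
star of σ. The subtracted mass moves to w, and both x and its image stay in the simplex `insert w
s`, where s is the support of x; if the minimum is zero, nothing moves. -/
theorem pushFace_mem {K : Set (Finset ι)} (hK : IsLowerSet K) {σ : Finset ι} (hσ : σ.Nonempty)
    {w : ι} (hw : w ∉ σ) (h : ∀ s ∈ K, σ ⊆ s → insert w s ∈ K) {x : ι → ℝ}
    (hx : x ∈ simplexUnion K) :
    pushFace σ hσ w x ∈ simplexUnion {s ∈ K | ¬ σ ⊆ s} ∧
      ∃ s ∈ K, (∀ v, v ∉ s → x v = 0) ∧ ∀ v, v ∉ s → pushFace σ hσ w x v = 0 := by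
  obtain ⟨s, hs, hsx, hs0, hs1⟩ := exists_support_of_mem_simplexUnion hK hx
  obtain ⟨u, hu, hxu⟩ := σ.exists_mem_eq_inf' hσ x
  rcases (hx.1 u).eq_or_lt with h0 | h0
  · have : pushFace σ hσ w x = x := pushFace_eq_self (by rw [hxu, ← h0])
    rw [this]
    refine ⟨⟨hx.1, s, ⟨hs, fun hσs => ?_⟩, hs0, hs1⟩, s, hs, hs0, hs0⟩
    exact h0.not_lt ((hsx u).1 (hσs hu))
  · have hσs : σ ⊆ s := fun v hv => (hsx v).2
      (h0.trans_le (hxu ▸ Finset.inf'_le x hv))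
    have hm : 0 < σ.inf' hσ x := by rwa [hxu]
    have hwu : u ≠ w := by rintro rfl; exact hw hu
    have hws := h s hs hσs
    have hoff : ∀ v, v ∉ insert w s → pushFace σ hσ w x v = 0 := by
      intro v hv
      have h1 : v ≠ w := by rintro rfl; exact hv (Finset.mem_insert_self _ _)
      have h2 : v ∉ s := fun h' => hv (Finset.mem_insert_of_mem h')
      have h3 : v ∉ σ := fun h' => h2 (hσs h')
      simp [pushFace, hs0 v h2, h1, h3]
    have hpu : pushFace σ hσ w x u = 0 := by simp [pushFace, hu, hwu, hxu]
    refine ⟨⟨fun v => ?_, (insert w s).erase u, ⟨hK (Finset.erase_subset _ _) hws, fun h' => ?_⟩,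
      fun v hv => ?_, ?_⟩, insert w s, hws,
      fun v hv => hs0 v fun h' => hv (Finset.mem_insert_of_mem h'), hoff⟩
    · have hc : (0 : ℝ) ≤ if v = w then σ.card * σ.inf' hσ x else 0 := by
        split_ifs <;> positivity
      refine add_nonneg (sub_nonneg.2 ?_) hc
      split_ifs with hv
      · exact Finset.inf'_le x hv
      · exact hx.1 v
    · exact absurd (h' hu) (Finset.notMem_erase _ _)
    · by_cases hvu : v = u
      · rw [hvu, hpu]
      · exact hoff v fun h' => hv (Finset.mem_erase.2 ⟨hvu, h'⟩)
    · rw [Finset.sum_erase _ hpu]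
      simp only [pushFace, Finset.sum_add_distrib, Finset.sum_sub_distrib]
      rw [Finset.sum_ite_eq', if_pos (Finset.mem_insert_self _ _), ← Finset.sum_filter,
        Finset.filter_mem_eq_inter,
        Finset.inter_eq_right.2 (hσs.trans (Finset.subset_insert _ _)), Finset.sum_const,
        sum_eq_one_of_mem_simplexUnion hx
          fun v hv => hs0 v fun h' => hv (Finset.mem_insert_of_mem h')]
      simp

/-- Removing the star of a face whose link is a cone does not change the homotopy type. -/
theorem nonempty_homotopyEquiv_expand {K : Set (Finset ι)} (hK : IsLowerSet K) {σ : Finset ι}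
    (hσ : σ.Nonempty) {w : ι} (hw : w ∉ σ) (h : ∀ s ∈ K, σ ⊆ s → insert w s ∈ K) :
    Nonempty (ContinuousMap.HomotopyEquiv (simplexUnion K) (simplexUnion {s ∈ K | ¬ σ ⊆ s})) := by
  have hsub : simplexUnion {s ∈ K | ¬ σ ⊆ s} ⊆ simplexUnion K :=
    simplexUnion_mono fun s hs => hs.1
  let r : C(simplexUnion K, simplexUnion {s ∈ K | ¬ σ ⊆ s}) :=
    ⟨fun x => ⟨pushFace σ hσ w x, (pushFace_mem hK hσ hw h x.2).1⟩,
      ((continuous_pushFace σ hσ w).comp continuous_subtype_val).subtype_mk _⟩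
  let i : C(simplexUnion {s ∈ K | ¬ σ ⊆ s}, simplexUnion K) :=
    ⟨Set.inclusion hsub, continuous_inclusion hsub⟩
  refine ⟨⟨r, i, homotopic_of_common_simplex _ _ fun x => ?_, ?_⟩⟩
  · obtain ⟨s, hs, h1, h2⟩ := (pushFace_mem hK hσ hw h x.2).2
    exact ⟨s, hs, h2, h1⟩
  · have : r.comp i = ContinuousMap.id _ := by
      ext x : 2
      refine pushFace_eq_self ?_
      obtain ⟨h0, s, ⟨-, hs⟩, hs0, -⟩ := x.2
      obtain ⟨u, hu, hus⟩ := Finset.not_subset.1 hs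
      exact le_antisymm ((Finset.inf'_le _ hu).trans (hs0 u hus).le)
        (Finset.le_inf' _ _ fun v _ => h0 v)
    rw [this]

theorem Collapsible.contractibleSpace {K : Set (Finset ι)} (h : Collapsible K)
    (hK : IsLowerSet K) : ContractibleSpace (simplexUnion K) := by
  induction h with
  | cone w h0 h => exact contractibleSpace_simplexUnion_cone w h0 h
  | expand σ w hσ hσ0 hw h _ ih =>
    have := ih fun s r hrs hs => ⟨hK hrs hs.1, fun h' => hs.2 (h'.trans hrs)⟩
    exact (nonempty_homotopyEquiv_expand hK hσ0 hw h).some.contractibleSpace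

end Realization

/-! ### Mapping cones and their homotopy invariance -/

section MappingCone

open ContinuousMap

variable {S Y Z : Type*} [TopologicalSpace S] [TopologicalSpace Y] [TopologicalSpace Z]

/-- The relation on `Y ⊕ S × [0, 1]` that glues the end of the cylinder to `Y` along `φ` and
collapses its beginning to a point. -/
inductive MappingConeRel (φ : C(S, Y)) : Y ⊕ S × unitInterval → Y ⊕ S × unitInterval → Prop
  | base (s : S) : MappingConeRel φ (Sum.inr (s, 1)) (Sum.inl (φ s))
  | apex (s s' : S) : MappingConeRel φ (Sum.inr (s, 0)) (Sum.inr (s', 0))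

/-- The mapping cone of a continuous map from a nonempty space. -/
abbrev MappingCone (φ : C(S, Y)) : Type _ := Quot (MappingConeRel φ)

namespace MappingCone

/-- The inclusion of the target into the mapping cone. -/
def inl (φ : C(S, Y)) : C(Y, MappingCone φ) :=
  ⟨fun y => Quot.mk _ (Sum.inl y), continuous_quot_mk.comp continuous_inl⟩

/-- The map from the cylinder to the mapping cone. -/
def cyl (φ : C(S, Y)) : C(S × unitInterval, MappingCone φ) :=
  ⟨fun p => Quot.mk _ (Sum.inr p), continuous_quot_mk.comp continuous_inr⟩

variable {φ : C(S, Y)}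

theorem cyl_one (s : S) : cyl φ (s, 1) = inl φ (φ s) := Quot.sound (.base s)

theorem cyl_zero (s s' : S) : cyl φ (s, 0) = cyl φ (s', 0) := Quot.sound (.apex s s')

theorem ind {p : MappingCone φ → Prop} (hl : ∀ y, p (inl φ y)) (hc : ∀ s τ, p (cyl φ (s, τ)))
    (x : MappingCone φ) : p x := by
  obtain ⟨y | ⟨s, τ⟩, rfl⟩ := Quot.exists_rep x
  · exact hl y
  · exact hc s τ

/-- A map out of a mapping cone. -/
def lift (f : C(Y, Z)) (g : C(S × unitInterval, Z)) (h1 : ∀ s, g (s, 1) = f (φ s))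
    (h0 : ∀ s s', g (s, 0) = g (s', 0)) : C(MappingCone φ, Z) :=
  ⟨Quot.lift (Sum.elim f g) (by rintro _ _ (s | ⟨s, s'⟩); exacts [h1 s, h0 s s']),
    continuous_quot_lift _ (f.continuous.sumElim g.continuous)⟩

@[simp] theorem lift_inl (f : C(Y, Z)) (g : C(S × unitInterval, Z)) (h1 : ∀ s, g (s, 1) = f (φ s))
    (h0 : ∀ s s', g (s, 0) = g (s', 0)) (y : Y) : lift f g h1 h0 (inl φ y) = f y := rfl

@[simp] theorem lift_cyl (f : C(Y, Z)) (g : C(S × unitInterval, Z)) (h1 : ∀ s, g (s, 1) = f (φ s))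
    (h0 : ∀ s s', g (s, 0) = g (s', 0)) (p : S × unitInterval) :
    lift f g h1 h0 (cyl φ p) = g p := rfl

/-- Homotopies of maps out of a mapping cone. -/
theorem homotopic {F G : C(MappingCone φ, Z)} (f : C(Y × unitInterval, Z))
    (g : C((S × unitInterval) × unitInterval, Z)) (h1 : ∀ s u, g ((s, 1), u) = f (φ s, u))
    (h0 : ∀ s s' u, g ((s, 0), u) = g ((s', 0), u)) (hF : ∀ y, f (y, 0) = F (inl φ y))
    (hG : ∀ y, f (y, 1) = G (inl φ y)) (hF' : ∀ p, g (p, 0) = F (cyl φ p))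
    (hG' : ∀ p, g (p, 1) = G (cyl φ p)) : F.Homotopic G := by
  -- Currying the homotopy turns it into a map from the cone to the path space, so the universal
  -- property of the quotient suffices and no product with a quotient is needed.
  let L : C(MappingCone φ, C(unitInterval, Z)) := lift f.curry g.curry
    (fun s => by ext u; exact h1 s u) (fun s s' => by ext u; exact h0 s s' u)
  refine ⟨⟨L.uncurry.comp ⟨Prod.swap, continuous_swap⟩, fun x => ?_, fun x => ?_⟩⟩
  · exact ind (p := fun x => L x 0 = F x) hF (fun s τ => hF' (s, τ)) x
  · exact ind (p := fun x => L x 1 = G x) hG (fun s τ => hG' (s, τ)) x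

variable {φ₀ φ₁ : C(S, Y)}

/-- The path in the mapping cone of `φ₀` that first runs along the cylinder and then along a
homotopy. -/
noncomputable def path (H : Homotopy φ₀ φ₁) : C(S × ℝ, MappingCone φ₀) where
  toFun p := if p.2 ≤ 1 then cyl φ₀ (p.1, Set.projIcc 0 1 zero_le_one p.2) else
    inl φ₀ (H (Set.projIcc 0 1 zero_le_one (p.2 - 1), p.1))
  continuous_toFun := by
    refine Continuous.if_le ?_ ?_ continuous_snd continuous_const ?_
    · exact (cyl φ₀).continuous.comp
        (continuous_fst.prodMk (continuous_projIcc.comp continuous_snd))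
    · exact (inl φ₀).continuous.comp (H.continuous.comp
        ((continuous_projIcc.comp (continuous_snd.sub continuous_const)).prodMk continuous_fst))
    · rintro ⟨s, x⟩ (rfl : x = 1)
      simp only [sub_self, Set.projIcc_left, Set.projIcc_right]
      exact (cyl_one s).trans (congrArg (inl φ₀) (H.apply_zero s).symm)

theorem path_of_le (H : Homotopy φ₀ φ₁) (s : S) {x : ℝ} (hx : x ≤ 1) :
    path H (s, x) = cyl φ₀ (s, Set.projIcc 0 1 zero_le_one x) := if_pos hx

theorem path_of_ge (H : Homotopy φ₀ φ₁) (s : S) {x : ℝ} (hx : 1 ≤ x) :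
    path H (s, x) = inl φ₀ (H (Set.projIcc 0 1 zero_le_one (x - 1), s)) := by
  rcases hx.eq_or_lt with rfl | hx
  · rw [path_of_le H s le_rfl]
    simp only [sub_self, Set.projIcc_left, Set.projIcc_right]
    exact (cyl_one s).trans (congrArg (inl φ₀) (H.apply_zero s).symm)
  · exact if_neg hx.not_ge

theorem path_zero (H : Homotopy φ₀ φ₁) (s s' : S) : path H (s, 0) = path H (s', 0) := by
  rw [path_of_le H s zero_le_one, path_of_le H s' zero_le_one, Set.projIcc_left]
  exact cyl_zero s s'

theorem path_coe (H : Homotopy φ₀ φ₁) (s : S) (τ : unitInterval) :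
    path H (s, (τ : ℝ)) = cyl φ₀ (s, τ) := by
  rw [path_of_le H s τ.2.2, Set.projIcc_val]

/-- The map of mapping cones given by a homotopy. -/
noncomputable def transport (H : Homotopy φ₀ φ₁) : C(MappingCone φ₁, MappingCone φ₀) :=
  lift (inl φ₀) ((path H).comp ⟨fun p => (p.1, 2 * (p.2 : ℝ)), by fun_prop⟩)
    (fun s => by
      have : (2 : ℝ) * ((1 : unitInterval) : ℝ) - 1 = 1 := by norm_num
      refine (path_of_ge H s (by norm_num)).trans ?_
      rw [this, Set.projIcc_right]
      exact congrArg (inl φ₀) (H.apply_one s))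
    (fun s s' => by
      simp only [comp_apply, coe_mk, Set.Icc.coe_zero, mul_zero]
      exact path_zero H s s')

theorem transport_cyl (H : Homotopy φ₀ φ₁) (s : S) (τ : unitInterval) :
    transport H (cyl φ₁ (s, τ)) = path H (s, 2 * (τ : ℝ)) := rfl

/-- On the cylinder the composite follows `path H` up to parameter 2 and then back to 1, since H' is
H reversed: the parameter is 4τ for τ ≤ 1/2 and 3 - 2τ afterwards, that is, their minimum. It is
deformed linearly to τ. -/
theorem transport_comp_transport (H : Homotopy φ₀ φ₁) (H' : Homotopy φ₁ φ₀)
    (hH : ∀ u s, H' (u, s) = H (unitInterval.symm u, s)) :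
    ((transport H).comp (transport H')).Homotopic (ContinuousMap.id _) := by
  refine homotopic ((inl φ₀).comp ⟨Prod.fst, continuous_fst⟩)
    ((path H).comp ⟨fun p => (p.1.1, (1 - (p.2 : ℝ)) * min (4 * (p.1.2 : ℝ)) (3 - 2 * (p.1.2 : ℝ)) +
      p.2 * p.1.2), by fun_prop⟩) ?_ ?_ (fun y => rfl) (fun y => rfl) ?_ ?_
  · intro s u
    have : (1 - (u : ℝ)) * min (4 * ((1 : unitInterval) : ℝ)) (3 - 2 * ((1 : unitInterval) : ℝ)) +
      u * ((1 : unitInterval) : ℝ) = ((1 : unitInterval) : ℝ) := by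
        norm_num
    simp only [comp_apply, coe_mk, this]
    rw [path_coe, cyl_one]
  · intro s s' u
    have : (1 - (u : ℝ)) * min (4 * ((0 : unitInterval) : ℝ)) (3 - 2 * ((0 : unitInterval) : ℝ)) +
      u * ((0 : unitInterval) : ℝ) = 0 := by
        norm_num
    simp only [comp_apply, coe_mk, this]
    exact path_zero H s s'
  · rintro ⟨s, τ⟩
    have : (1 - ((0 : unitInterval) : ℝ)) * min (4 * (τ : ℝ)) (3 - 2 * (τ : ℝ)) +
      ((0 : unitInterval) : ℝ) * τ = min (4 * (τ : ℝ)) (3 - 2 * (τ : ℝ)) := by simp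
    simp only [comp_apply, coe_mk, this, transport_cyl]
    have h0 := τ.2.1
    have h1 := τ.2.2
    rcases le_total (2 * (τ : ℝ)) 1 with h | h
    · rw [path_of_le H' s h, transport_cyl, min_eq_left (by linarith),
        Set.projIcc_of_mem zero_le_one ⟨by linarith, h⟩]
      congr 2
      ring
    · rw [path_of_ge H' s h, min_eq_right (by linarith), path_of_ge H s (by linarith), hH,
        Set.projIcc_of_mem zero_le_one (x := 2 * (τ : ℝ) - 1) ⟨by linarith, by linarith⟩,
        Set.projIcc_of_mem zero_le_one (x := 3 - 2 * (τ : ℝ) - 1) ⟨by linarith, by linarith⟩]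
      refine congrArg (inl φ₀) (congrArg H (Prod.ext (Subtype.ext ?_) rfl))
      simp only [unitInterval.coe_symm_eq]
      ring
  · rintro ⟨s, τ⟩
    have : (1 - ((1 : unitInterval) : ℝ)) * min (4 * (τ : ℝ)) (3 - 2 * (τ : ℝ)) +
      ((1 : unitInterval) : ℝ) * τ = τ := by simp
    simp only [comp_apply, coe_mk, this]
    exact path_coe H s τ

/-- Homotopic maps have homotopy equivalent mapping cones. -/
noncomputable def transportEquiv (H : Homotopy φ₀ φ₁) :
    HomotopyEquiv (MappingCone φ₁) (MappingCone φ₀) where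
  toFun := transport H
  invFun := transport H.symm
  left_inv := transport_comp_transport _ _ fun u s => by
    rw [Homotopy.symm_apply, unitInterval.symm_symm]
  right_inv := transport_comp_transport _ _ fun _ _ => rfl

/-- The map of mapping cones given by a map of the targets. -/
def map (f : C(Y, Z)) : C(MappingCone φ, MappingCone (f.comp φ)) :=
  lift ((inl _).comp f) (cyl _) cyl_one cyl_zero

/-- The mapping cone map given by a self-map homotopic to the identity is a homotopy equivalence. -/
theorem exists_homotopyEquiv_map {h : C(Y, Y)} (H : Homotopy (ContinuousMap.id Y) h) (φ : C(S, Y)) :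
    ∃ e : HomotopyEquiv (MappingCone φ) (MappingCone (h.comp φ)), e.toFun.Homotopic (map h) := by
  let H' : Homotopy φ (h.comp φ) :=
    ⟨⟨fun p => H (p.1, φ p.2), by fun_prop⟩, fun s => H.apply_zero _, fun s => H.apply_one _⟩
  have key : ((transport H').comp (map h)).Homotopic (ContinuousMap.id (MappingCone φ)) := by
    -- While the target moves along H, the cylinder parameter is stretched from τ to 2τ, which is
    -- the parameter of `transport H'`.
    refine Homotopic.symm (homotopic ((inl φ).comp ⟨fun p => H (p.2, p.1), by fun_prop⟩)
      ((path H').comp ⟨fun p => (p.1.1, (p.1.2 : ℝ) * (1 + p.2)), by fun_prop⟩) ?_ ?_ ?_ ?_ ?_ ?_)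
    · intro s u
      have h1 : ((1 : unitInterval) : ℝ) * (1 + u) = 1 + u := by simp
      have h2 : (1 : ℝ) + u - 1 = u := by ring
      simp only [comp_apply, coe_mk, h1]
      rw [path_of_ge H' s (by linarith [u.2.1]), h2, Set.projIcc_val]
      rfl
    · intro s s' u
      simp only [comp_apply, coe_mk, Set.Icc.coe_zero, zero_mul]
      exact path_zero H' s s'
    · intro y
      exact congrArg (inl φ) (H.apply_zero y)
    · intro y
      exact congrArg (inl φ) (H.apply_one y)
    · rintro ⟨s, τ⟩
      simp only [comp_apply, coe_mk, Set.Icc.coe_zero, add_zero, mul_one]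
      exact path_coe H' s τ
    · rintro ⟨s, τ⟩
      have : (τ : ℝ) * (1 + ((1 : unitInterval) : ℝ)) = 2 * τ := by
        norm_num
        ring
      simp only [comp_apply, coe_mk, this]
      rfl
  refine ⟨(transportEquiv H').symm, ?_⟩
  have h1 : ((transportEquiv H').symm.toFun.comp ((transport H').comp (map h))).Homotopic
      ((transportEquiv H').symm.toFun.comp (ContinuousMap.id _)) :=
    Homotopic.comp (Homotopic.refl _) key
  have h2 : (((transportEquiv H').symm.toFun.comp (transport H')).comp (map h)).Homotopic
      ((ContinuousMap.id _).comp (map h)) :=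
    Homotopic.comp (transportEquiv H').left_inv (Homotopic.refl _)
  exact h1.symm.trans h2

end MappingCone

/-- A map is a homotopy equivalence if its compositions with two further maps in a row are. -/
theorem nonempty_homotopyEquiv_of_two_of_six {X₀ X₁ X₂ X₃ : Type*} [TopologicalSpace X₀]
    [TopologicalSpace X₁] [TopologicalSpace X₂] [TopologicalSpace X₃] {f : C(X₀, X₁)}
    {g : C(X₁, X₂)} {h : C(X₂, X₃)} (e : HomotopyEquiv X₀ X₂) (e' : HomotopyEquiv X₁ X₃)
    (he : e.toFun.Homotopic (g.comp f)) (he' : e'.toFun.Homotopic (h.comp g)) :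
    Nonempty (HomotopyEquiv X₁ X₂) := by
  have hr : (g.comp (f.comp e.invFun)).Homotopic (ContinuousMap.id _) :=
    (Homotopic.comp he.symm (Homotopic.refl e.invFun)).trans e.right_inv
  have hl : ((e'.invFun.comp h).comp g).Homotopic (ContinuousMap.id _) :=
    (Homotopic.comp (Homotopic.refl e'.invFun) he'.symm).trans e'.left_inv
  have h1 : (((e'.invFun.comp h).comp g).comp (f.comp e.invFun)).Homotopic
      ((ContinuousMap.id _).comp (f.comp e.invFun)) := Homotopic.comp hl (Homotopic.refl _)
  have h2 : ((e'.invFun.comp h).comp (g.comp (f.comp e.invFun))).Homotopic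
      ((e'.invFun.comp h).comp (ContinuousMap.id _)) := Homotopic.comp (Homotopic.refl _) hr
  have h3 : (f.comp e.invFun).Homotopic (e'.invFun.comp h) := h1.symm.trans h2
  exact ⟨⟨g, f.comp e.invFun, (Homotopic.comp h3 (Homotopic.refl g)).trans hl, hr⟩⟩

/-- Mapping cones of maps that correspond under a homotopy equivalence are homotopy equivalent. -/
theorem MappingCone.nonempty_homotopyEquiv (φ : C(S, Y)) (ψ : C(S, Z)) (e : HomotopyEquiv Y Z)
    (h : (e.toFun.comp φ).Homotopic ψ) :
    Nonempty (HomotopyEquiv (MappingCone φ) (MappingCone ψ)) := by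
  obtain ⟨H⟩ := e.left_inv
  obtain ⟨H'⟩ := e.right_inv
  obtain ⟨e₁, he₁⟩ := exists_homotopyEquiv_map H.symm φ
  obtain ⟨e₂, he₂⟩ := exists_homotopyEquiv_map H'.symm (e.toFun.comp φ)
  obtain ⟨H''⟩ := h
  -- The maps induced by e, its inverse and e again have both consecutive compositions homotopic to
  -- equivalences, so the two-out-of-six property applies.
  have hc₁ : (map (e.invFun.comp e.toFun) : C(MappingCone φ, _)) =
      (map e.invFun : C(MappingCone (e.toFun.comp φ), _)).comp (map e.toFun) := by
    ext x
    induction x using ind with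
    | hl y => rfl
    | hc s τ => rfl
  have hc₂ : (map (e.toFun.comp e.invFun) : C(MappingCone (e.toFun.comp φ), _)) =
      (map e.toFun : C(MappingCone (e.invFun.comp (e.toFun.comp φ)), _)).comp (map e.invFun) := by
    ext x
    induction x using ind with
    | hl y => rfl
    | hc s τ => rfl
  rw [hc₁] at he₁
  rw [hc₂] at he₂
  obtain ⟨e₃⟩ := nonempty_homotopyEquiv_of_two_of_six e₁ e₂ he₁ he₂
  exact ⟨(e₁.trans e₃.symm).trans (transportEquiv H'').symm⟩

end MappingCone

/-! ### Spheres as suspensions, and wedges of spheres -/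

section Spheres

open ContinuousMap

/-- The map from the cylinder over a sphere onto the sphere of the next dimension, which collapses
both ends. -/
noncomputable def suspensionMap (d : ℕ) : C(UnitSphere d × unitInterval, UnitSphere (d + 1)) where
  -- At height 2τ - 1 the parallel of the unit sphere has radius 2√(τ(1 - τ)).
  toFun p := ⟨WithLp.toLp 2 (Fin.cons (2 * (p.2 : ℝ) - 1)
    fun i => 2 * √(p.2 * (1 - p.2)) * (p.1 : EuclideanSpace ℝ (Fin (d + 1))) i), by
      have h : ∑ i, ((p.1 : EuclideanSpace ℝ (Fin (d + 1))) i) ^ 2 = 1 := by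
        rw [← EuclideanSpace.real_norm_sq_eq, mem_sphere_zero_iff_norm.1 p.1.2, one_pow]
      have hs : √((p.2 : ℝ) * (1 - p.2)) ^ 2 = p.2 * (1 - p.2) :=
        Real.sq_sqrt (mul_nonneg p.2.2.1 (sub_nonneg.2 p.2.2.2))
      rw [mem_sphere_zero_iff_norm, ← sq_eq_sq₀ (norm_nonneg _) zero_le_one,
        EuclideanSpace.real_norm_sq_eq, Fin.sum_univ_succ]
      simp only [Fin.cons_zero, Fin.cons_succ, mul_pow, ← Finset.mul_sum, h, hs]
      ring⟩
  continuous_toFun := by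
    refine Continuous.subtype_mk ((PiLp.continuous_toLp 2 _).comp (continuous_pi fun i => ?_)) _
    refine Fin.cases ?_ (fun i => ?_) i
    · simp only [Fin.cons_zero]
      fun_prop
    · simp only [Fin.cons_succ]
      have : Continuous fun p : UnitSphere d × unitInterval =>
          (p.1 : EuclideanSpace ℝ (Fin (d + 1))) i :=
        (EuclideanSpace.proj (𝕜 := ℝ) i).continuous.comp
          (continuous_subtype_val.comp continuous_fst)
      fun_prop

theorem suspensionMap_apply_zero {d : ℕ} (p : UnitSphere d × unitInterval) :
    (suspensionMap d p : EuclideanSpace ℝ (Fin (d + 2))) 0 = 2 * (p.2 : ℝ) - 1 := rfl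

theorem suspensionMap_apply_succ {d : ℕ} (p : UnitSphere d × unitInterval) (i : Fin (d + 1)) :
    (suspensionMap d p : EuclideanSpace ℝ (Fin (d + 2))) i.succ =
      2 * √(p.2 * (1 - p.2)) * (p.1 : EuclideanSpace ℝ (Fin (d + 1))) i := rfl

theorem suspensionMap_one {d : ℕ} (s : UnitSphere d) :
    suspensionMap d (s, 1) = UnitSphere.base (d + 1) := by
  refine Subtype.ext (PiLp.ext fun i => ?_)
  refine Fin.cases ?_ (fun i => ?_) i
  · rw [suspensionMap_apply_zero]
    simp [UnitSphere.base]
    norm_num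
  · rw [suspensionMap_apply_succ]
    simp [UnitSphere.base]

theorem suspensionMap_zero {d : ℕ} (s s' : UnitSphere d) :
    suspensionMap d (s, 0) = suspensionMap d (s', 0) := by
  refine Subtype.ext (PiLp.ext fun i => ?_)
  refine Fin.cases ?_ (fun i => ?_) i
  · rw [suspensionMap_apply_zero, suspensionMap_apply_zero]
  · rw [suspensionMap_apply_succ, suspensionMap_apply_succ]
    simp

theorem suspensionMap_injective {d : ℕ} {s s' : UnitSphere d} {τ τ' : unitInterval}
    (h : suspensionMap d (s, τ) = suspensionMap d (s', τ')) :
    τ = τ' ∧ (τ = 0 ∨ τ = 1 ∨ s = s') := by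
  have h0 : 2 * (τ : ℝ) - 1 = 2 * (τ' : ℝ) - 1 := by
    rw [← suspensionMap_apply_zero (s, τ), h, suspensionMap_apply_zero]
  have hτ : τ = τ' := Subtype.ext (by linarith)
  subst hτ
  refine ⟨rfl, ?_⟩
  by_contra! hne
  have h1 : (τ : ℝ) ≠ 0 := fun h' => hne.1 (Subtype.ext h')
  have h2 : (τ : ℝ) ≠ 1 := fun h' => hne.2.1 (Subtype.ext h')
  have h3 : 0 < √((τ : ℝ) * (1 - τ)) :=
    Real.sqrt_pos.2 (mul_pos (τ.2.1.lt_of_ne h1.symm) (sub_pos.2 (τ.2.2.lt_of_ne h2)))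
  refine hne.2.2 (Subtype.ext (PiLp.ext fun i => ?_))
  have := congrArg (fun x : UnitSphere (d + 1) => (x : EuclideanSpace ℝ (Fin (d + 2))) i.succ) h
  simp only [suspensionMap_apply_succ] at this
  exact mul_left_cancel₀ (by positivity) this

theorem suspensionMap_surjective (d : ℕ) : Function.Surjective (suspensionMap d) := by
  intro x
  have hx : ((x : EuclideanSpace ℝ (Fin (d + 2))) 0) ^ 2 +
      ∑ i : Fin (d + 1), ((x : EuclideanSpace ℝ (Fin (d + 2))) i.succ) ^ 2 = 1 := by
    rw [← Fin.sum_univ_succ (fun i => ((x : EuclideanSpace ℝ (Fin (d + 2))) i) ^ 2),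
      ← EuclideanSpace.real_norm_sq_eq, mem_sphere_zero_iff_norm.1 x.2, one_pow]
  set a := (x : EuclideanSpace ℝ (Fin (d + 2))) 0 with ha
  let y : EuclideanSpace ℝ (Fin (d + 1)) :=
    WithLp.toLp 2 fun i => (x : EuclideanSpace ℝ (Fin (d + 2))) i.succ
  have hy : ‖y‖ ^ 2 = 1 - a ^ 2 := by
    rw [EuclideanSpace.real_norm_sq_eq]
    linarith
  have ha1 : a ^ 2 ≤ 1 := by nlinarith [sq_nonneg ‖y‖]
  obtain ⟨ha2, ha3⟩ := abs_le.1 ((sq_le_one_iff_abs_le_one a).1 ha1)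
  let τ : unitInterval := ⟨(1 + a) / 2, by linarith, by linarith⟩
  have hτ : 2 * √((τ : ℝ) * (1 - τ)) = ‖y‖ := by
    have : (τ : ℝ) * (1 - τ) = (‖y‖ / 2) ^ 2 := by
      rw [div_pow, hy]
      simp only [τ]
      ring
    rw [this, Real.sqrt_sq (by positivity)]
    ring
  obtain ⟨s, hs⟩ : ∃ s : UnitSphere d, ‖y‖ • (s : EuclideanSpace ℝ (Fin (d + 1))) = y := by
    by_cases hy0 : y = 0
    · exact ⟨UnitSphere.base d, by simp [hy0]⟩
    · have : ‖y‖ ≠ 0 := norm_ne_zero_iff.2 hy0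
      refine ⟨⟨‖y‖⁻¹ • y, ?_⟩, ?_⟩
      · rw [mem_sphere_zero_iff_norm, norm_smul, norm_inv, norm_norm, inv_mul_cancel₀ this]
      · simp [smul_smul, this]
  refine ⟨(s, τ), Subtype.ext (PiLp.ext fun i => ?_)⟩
  refine Fin.cases ?_ (fun i => ?_) i
  · rw [suspensionMap_apply_zero]
    simp only [τ]
    ring
  · rw [suspensionMap_apply_succ, hτ]
    have := congrArg (fun z : EuclideanSpace ℝ (Fin (d + 1)) => z i) hs
    simpa [y] using this

/-- A continuous surjection from a compact space onto a Hausdorff space is closed, hence a quotient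
map. -/
theorem isQuotientMap_suspensionMap (d : ℕ) : Topology.IsQuotientMap (suspensionMap d) :=
  (suspensionMap d).continuous.isClosedMap.isQuotientMap (suspensionMap d).continuous
    (suspensionMap_surjective d)

variable {W : Type*} [TopologicalSpace W]

theorem cyl_eq_of_suspensionMap_eq {d : ℕ} (w : W) {p p' : UnitSphere d × unitInterval}
    (h : suspensionMap d p = suspensionMap d p') :
    MappingCone.cyl (ContinuousMap.const (UnitSphere d) w) p = MappingCone.cyl _ p' := by
  obtain ⟨s, τ⟩ := p
  obtain ⟨s', τ'⟩ := p'
  obtain ⟨rfl, rfl | rfl | rfl⟩ := suspensionMap_injective h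
  · exact MappingCone.cyl_zero s s'
  · exact (MappingCone.cyl_one s).trans (MappingCone.cyl_one s').symm
  · rfl

/-- The sphere in the mapping cone of a constant map. -/
noncomputable def sphereToMappingCone (d : ℕ) (w : W) :
    C(UnitSphere (d + 1), MappingCone (ContinuousMap.const (UnitSphere d) w)) :=
  (isQuotientMap_suspensionMap d).lift (MappingCone.cyl _)
    fun _ _ => cyl_eq_of_suspensionMap_eq w

theorem sphereToMappingCone_suspensionMap {d : ℕ} (w : W) (p : UnitSphere d × unitInterval) :
    sphereToMappingCone d w (suspensionMap d p) = MappingCone.cyl _ p :=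
  DFunLike.congr_fun ((isQuotientMap_suspensionMap d).lift_comp (MappingCone.cyl _)
    fun _ _ => cyl_eq_of_suspensionMap_eq w) p

theorem sphereToMappingCone_base (d : ℕ) (w : W) :
    sphereToMappingCone d w (UnitSphere.base (d + 1)) = MappingCone.inl _ w := by
  rw [← suspensionMap_one (UnitSphere.base d), sphereToMappingCone_suspensionMap,
    MappingCone.cyl_one]
  rfl

/-- The base point of a wedge of spheres. -/
noncomputable def WedgeOfSpheres.base {k : ℕ} (n : Fin (k + 1) → ℕ) : WedgeOfSpheres n :=
  Quot.mk _ ⟨0, UnitSphere.base (n 0)⟩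

theorem WedgeOfSpheres.mk_base {k : ℕ} (n : Fin (k + 1) → ℕ) (i : Fin (k + 1)) :
    (Quot.mk _ ⟨i, UnitSphere.base (n i)⟩ : WedgeOfSpheres n) = WedgeOfSpheres.base n :=
  Quot.sound (.base i 0)

/-- The inclusion of a sphere into a wedge of spheres. -/
def WedgeOfSpheres.incl {k : ℕ} (n : Fin (k + 1) → ℕ) (i : Fin (k + 1)) :
    C(UnitSphere (n i), WedgeOfSpheres n) :=
  ⟨fun x => Quot.mk _ ⟨i, x⟩, continuous_quot_mk.comp continuous_sigmaMk⟩

/-- A map out of a wedge of spheres. -/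
def WedgeOfSpheres.lift {k : ℕ} {n : Fin (k + 1) → ℕ} (f : ∀ i, C(UnitSphere (n i), W)) (w : W)
    (hf : ∀ i, f i (UnitSphere.base (n i)) = w) : C(WedgeOfSpheres n, W) :=
  ⟨Quot.lift (fun x => f x.1 x.2) (by rintro _ _ ⟨i, j⟩; exact (hf i).trans (hf j).symm),
    continuous_quot_lift _ (continuous_sigma fun i => (f i).continuous)⟩

/-- Attaching a cell to a wedge of spheres along a constant map adds a sphere. -/
noncomputable def mappingConeConstHomeomorph {k : ℕ} (n : Fin (k + 1) → ℕ) (d : ℕ) :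
    MappingCone (ContinuousMap.const (UnitSphere d) (WedgeOfSpheres.base n)) ≃ₜ
      WedgeOfSpheres (Fin.cons (d + 1) n : Fin (k + 2) → ℕ) where
  toFun := MappingCone.lift
    (WedgeOfSpheres.lift (fun i => WedgeOfSpheres.incl (Fin.cons (d + 1) n : Fin (k + 2) → ℕ) i.succ)
      (WedgeOfSpheres.base _) fun i => WedgeOfSpheres.mk_base _ i.succ)
    ((WedgeOfSpheres.incl (Fin.cons (d + 1) n : Fin (k + 2) → ℕ) 0).comp (suspensionMap d))
    (fun s => (congrArg (WedgeOfSpheres.incl (Fin.cons (d + 1) n : Fin (k + 2) → ℕ) 0)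
      (suspensionMap_one s)).trans
      ((WedgeOfSpheres.mk_base (Fin.cons (d + 1) n : Fin (k + 2) → ℕ) 0).trans
        (WedgeOfSpheres.mk_base (Fin.cons (d + 1) n : Fin (k + 2) → ℕ) 1).symm))
    (fun s s' => congrArg (WedgeOfSpheres.incl (Fin.cons (d + 1) n : Fin (k + 2) → ℕ) 0)
      (suspensionMap_zero s s'))
  invFun := WedgeOfSpheres.lift (n := (Fin.cons (d + 1) n : Fin (k + 2) → ℕ))
    (Fin.cases (sphereToMappingCone d _) fun i =>
      (MappingCone.inl _).comp (WedgeOfSpheres.incl n i))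
    (MappingCone.inl _ (WedgeOfSpheres.base n))
    (Fin.cases (sphereToMappingCone_base d _) fun i =>
      congrArg (MappingCone.inl _) (WedgeOfSpheres.mk_base n i))
  left_inv x := by
    induction x using MappingCone.ind with
    | hl y =>
      obtain ⟨⟨i, y⟩, rfl⟩ := Quot.exists_rep y
      rfl
    | hc s τ => exact sphereToMappingCone_suspensionMap _ (s, τ)
  right_inv x := by
    obtain ⟨⟨i, y⟩, rfl⟩ := Quot.exists_rep x
    revert y
    refine Fin.cases (fun y => ?_) (fun i y => rfl) i
    obtain ⟨p, rfl⟩ := suspensionMap_surjective d y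
    exact congrArg _ (sphereToMappingCone_suspensionMap _ p)
  continuous_toFun := ContinuousMap.continuous _
  continuous_invFun := ContinuousMap.continuous _

/-- Attaching a cell to a point gives a sphere. -/
noncomputable def mappingConeUnitHomeomorph (d : ℕ) :
    MappingCone (ContinuousMap.const (UnitSphere d) ()) ≃ₜ
      WedgeOfSpheres (fun _ : Fin 1 => d + 1) where
  toFun := MappingCone.lift
    (ContinuousMap.const _ (WedgeOfSpheres.base _))
    ((WedgeOfSpheres.incl (fun _ : Fin 1 => d + 1) 0).comp (suspensionMap d))
    (fun s => congrArg (WedgeOfSpheres.incl (fun _ : Fin 1 => d + 1) 0) (suspensionMap_one s))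
    (fun s s' => congrArg (WedgeOfSpheres.incl (fun _ : Fin 1 => d + 1) 0) (suspensionMap_zero s s'))
  invFun := WedgeOfSpheres.lift (n := fun _ : Fin 1 => d + 1)
    (fun _ => sphereToMappingCone d _) (MappingCone.inl _ ())
    (fun _ => sphereToMappingCone_base d _)
  left_inv x := by
    induction x using MappingCone.ind with
    | hl y => exact sphereToMappingCone_base d ()
    | hc s τ => exact sphereToMappingCone_suspensionMap _ (s, τ)
  right_inv x := by
    obtain ⟨⟨i, y⟩, rfl⟩ := Quot.exists_rep x
    obtain rfl : i = 0 := Fin.fin_one_eq_zero i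
    obtain ⟨p, rfl⟩ := suspensionMap_surjective d y
    exact congrArg _ (sphereToMappingCone_suspensionMap _ p)
  continuous_toFun := ContinuousMap.continuous _
  continuous_invFun := ContinuousMap.continuous _

theorem pathConnectedSpace_unitSphere {d : ℕ} (hd : 0 < d) : PathConnectedSpace (UnitSphere d) := by
  rw [← isPathConnected_iff_pathConnectedSpace]
  refine isPathConnected_sphere ?_ _ zero_le_one
  rw [← Module.finrank_eq_rank, finrank_euclideanSpace_fin]
  exact_mod_cast Nat.succ_lt_succ hd

theorem WedgeOfSpheres.joined_base {k : ℕ} {n : Fin (k + 1) → ℕ} (hn : ∀ i, 0 < n i)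
    (x : WedgeOfSpheres n) : Joined x (WedgeOfSpheres.base n) := by
  obtain ⟨⟨i, y⟩, rfl⟩ := Quot.exists_rep x
  have := pathConnectedSpace_unitSphere (hn i)
  rw [← WedgeOfSpheres.mk_base n i]
  exact (PathConnectedSpace.joined y (UnitSphere.base (n i))).map
    (WedgeOfSpheres.incl n i).continuous

/-- The spaces that are contractible or homotopy equivalent to a wedge of spheres of positive
dimensions. -/
def IsConnectedSphereWedge (X : Type*) [TopologicalSpace X] : Prop :=
  ContractibleSpace X ∨ ∃ (k : ℕ) (n : Fin (k + 1) → ℕ), (∀ i, 0 < n i) ∧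
    Nonempty (HomotopyEquiv X (WedgeOfSpheres n))

theorem IsConnectedSphereWedge.of_homotopyEquiv {X Y : Type*} [TopologicalSpace X]
    [TopologicalSpace Y] (hY : IsConnectedSphereWedge Y) (e : HomotopyEquiv X Y) :
    IsConnectedSphereWedge X := by
  rcases hY with hY | ⟨k, n, hn, ⟨f⟩⟩
  · exact Or.inl e.contractibleSpace
  · exact Or.inr ⟨k, n, hn, ⟨e.trans f⟩⟩

/-- Attaching a cell along a null-homotopic map adds a sphere to a wedge of spheres. -/
theorem IsConnectedSphereWedge.mappingCone {Y : Type*} [TopologicalSpace Y]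
    (hY : IsConnectedSphereWedge Y) {d : ℕ} {φ : C(UnitSphere d, Y)} (hφ : φ.Nullhomotopic) :
    IsConnectedSphereWedge (MappingCone φ) := by
  obtain ⟨y, hy⟩ := hφ
  rcases hY with hY | ⟨k, n, hn, ⟨f⟩⟩
  · obtain ⟨e⟩ := ContractibleSpace.hequiv_unit Y
    obtain ⟨e'⟩ := MappingCone.nonempty_homotopyEquiv φ (ContinuousMap.const (UnitSphere d) ()) e
      ((Homotopic.refl _))
    exact Or.inr ⟨0, fun _ => d + 1, fun _ => d.succ_pos,
      ⟨e'.trans (mappingConeUnitHomeomorph d).toHomotopyEquiv⟩⟩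
  · have h1 : (f.toFun.comp φ).Homotopic (f.toFun.comp (ContinuousMap.const _ y)) :=
      Homotopic.comp (Homotopic.refl _) hy
    -- Positive dimensions make the wedge path connected, so the constant map can be moved to the
    -- base point.
    obtain ⟨γ⟩ := WedgeOfSpheres.joined_base hn (f.toFun y)
    have h2 : (f.toFun.comp (ContinuousMap.const (UnitSphere d) y)).Homotopic
        (ContinuousMap.const _ (WedgeOfSpheres.base n)) :=
      ⟨⟨⟨fun p => γ p.1, by fun_prop⟩, fun _ => γ.source, fun _ => γ.target⟩⟩
    obtain ⟨e'⟩ := MappingCone.nonempty_homotopyEquiv φ _ f (h1.trans h2)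
    refine Or.inr ⟨k + 1, Fin.cons (d + 1) n, ?_,
      ⟨e'.trans (mappingConeConstHomeomorph n d).toHomotopyEquiv⟩⟩
    exact Fin.cases d.succ_pos hn

end Spheres

/-! ### Simplices in polar coordinates, and attaching a maximal face -/

section Cells

open ContinuousMap

/-- Points of `ℝᵈ⁺¹` as points of `ℝᵈ⁺²` with vanishing sum of coordinates. -/
def sumZeroLift {d : ℕ} (x : EuclideanSpace ℝ (Fin (d + 1))) : Fin (d + 2) → ℝ :=
  Fin.cons (-∑ i, x i) fun i => x i

theorem sum_sumZeroLift {d : ℕ} (x : EuclideanSpace ℝ (Fin (d + 1))) :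
    ∑ i, sumZeroLift x i = 0 := by
  simp [sumZeroLift, Fin.sum_univ_succ]

theorem sumZeroLift_smul {d : ℕ} (c : ℝ) (x : EuclideanSpace ℝ (Fin (d + 1))) :
    sumZeroLift (c • x) = c • sumZeroLift x := by
  ext i
  refine Fin.cases ?_ (fun i => ?_) i
  · simp [sumZeroLift, Finset.mul_sum]
  · simp [sumZeroLift]

theorem sumZeroLift_injective {d : ℕ} : Function.Injective (sumZeroLift (d := d)) := by
  intro x y h
  ext i
  simpa [sumZeroLift] using congrFun h i.succ

theorem continuous_sumZeroLift {d : ℕ} : Continuous (sumZeroLift (d := d)) := by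
  have h : ∀ i, Continuous fun x : EuclideanSpace ℝ (Fin (d + 1)) => x i :=
    fun i => (EuclideanSpace.proj (𝕜 := ℝ) i).continuous
  refine continuous_pi fun i => ?_
  refine Fin.cases ?_ (fun i => ?_) i
  · simp only [sumZeroLift, Fin.cons_zero]
    exact (continuous_finsetSum _ fun i _ => h i).neg
  · simpa only [sumZeroLift, Fin.cons_succ] using h i

/-- The largest negative of a coordinate of `sumZeroLift x`. -/
noncomputable def depth {d : ℕ} (x : EuclideanSpace ℝ (Fin (d + 1))) : ℝ :=
  Finset.univ.sup' Finset.univ_nonempty fun i => -sumZeroLift x i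

theorem continuous_depth {d : ℕ} : Continuous (depth (d := d)) :=
  Continuous.finset_sup'_apply _ fun i _ => ((continuous_apply i).comp continuous_sumZeroLift).neg

theorem neg_sumZeroLift_le_depth {d : ℕ} (x : EuclideanSpace ℝ (Fin (d + 1))) (i : Fin (d + 2)) :
    -sumZeroLift x i ≤ depth x :=
  Finset.le_sup' (fun i => -sumZeroLift x i) (Finset.mem_univ i)

theorem exists_depth_eq {d : ℕ} (x : EuclideanSpace ℝ (Fin (d + 1))) :
    ∃ i, depth x = -sumZeroLift x i := by
  obtain ⟨i, -, hi⟩ := Finset.exists_mem_eq_sup' Finset.univ_nonempty fun i => -sumZeroLift x i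
  exact ⟨i, hi⟩

theorem depth_smul {d : ℕ} {c : ℝ} (hc : 0 ≤ c) (x : EuclideanSpace ℝ (Fin (d + 1))) :
    depth (c • x) = c * depth x := by
  obtain ⟨i, hi⟩ := exists_depth_eq x
  obtain ⟨j, hj⟩ := exists_depth_eq (c • x)
  have h1 := neg_sumZeroLift_le_depth (c • x) i
  have h2 := mul_le_mul_of_nonneg_left (neg_sumZeroLift_le_depth x j) hc
  rw [sumZeroLift_smul, Pi.smul_apply, smul_eq_mul] at h1 hj
  rw [hi] at h2 ⊢
  linarith

theorem depth_pos {d : ℕ} {x : EuclideanSpace ℝ (Fin (d + 1))} (hx : x ≠ 0) : 0 < depth x := by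
  by_contra! h
  have h0 : ∀ i, 0 ≤ sumZeroLift x i := fun i => by
    have := neg_sumZeroLift_le_depth x i
    linarith
  have h1 := (Finset.sum_eq_zero_iff_of_nonneg fun i _ => h0 i).1 (sum_sumZeroLift x)
  refine hx (sumZeroLift_injective ?_)
  ext i
  rw [h1 i (Finset.mem_univ i)]
  refine Fin.cases ?_ (fun i => ?_) i <;> simp [sumZeroLift]

theorem UnitSphere.depth_pos {d : ℕ} (s : UnitSphere d) :
    0 < depth (s : EuclideanSpace ℝ (Fin (d + 1))) :=
  _root_.depth_pos fun h => by
    have := mem_sphere_zero_iff_norm.1 s.2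
    simp [h] at this

/-- Polar coordinates on the standard simplex, centred at its barycentre. -/
noncomputable def simplexPolar {d : ℕ} (p : UnitSphere d × unitInterval) (i : Fin (d + 2)) : ℝ :=
  (1 + p.2 * (sumZeroLift (p.1 : EuclideanSpace ℝ (Fin (d + 1))) i /
    depth (p.1 : EuclideanSpace ℝ (Fin (d + 1))))) / (d + 2)

theorem continuous_simplexPolar {d : ℕ} : Continuous (simplexPolar (d := d)) := by
  refine continuous_pi fun i => Continuous.div_const (continuous_const.add ?_) _
  refine (continuous_subtype_val.comp continuous_snd).mul (Continuous.div ?_ ?_ fun p => ?_)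
  · exact (continuous_apply i).comp
      (continuous_sumZeroLift.comp (continuous_subtype_val.comp continuous_fst))
  · exact continuous_depth.comp (continuous_subtype_val.comp continuous_fst)
  · exact p.1.depth_pos.ne'

theorem sum_simplexPolar {d : ℕ} (p : UnitSphere d × unitInterval) :
    ∑ i, simplexPolar p i = 1 := by
  have : (d : ℝ) + 2 ≠ 0 := by positivity
  simp only [simplexPolar, ← Finset.sum_div, Finset.sum_add_distrib, ← Finset.mul_sum,
    sum_sumZeroLift]
  simp [this]

/-- Dividing by the depth makes the most negative direction coordinate equal to -1, so the smallest
barycentric coordinate is (1 - τ) / (d + 2). It determines the radius τ, and it vanishes exactly on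
the boundary τ = 1. -/
theorem le_simplexPolar {d : ℕ} (p : UnitSphere d × unitInterval) (i : Fin (d + 2)) :
    (1 - (p.2 : ℝ)) / (d + 2) ≤ simplexPolar p i := by
  have h := p.1.depth_pos
  refine div_le_div_of_nonneg_right ?_ (by positivity)
  have h1 : -1 ≤ sumZeroLift (p.1 : EuclideanSpace ℝ (Fin (d + 1))) i /
      depth (p.1 : EuclideanSpace ℝ (Fin (d + 1))) := by
    rw [le_div_iff₀ h]
    have := neg_sumZeroLift_le_depth (p.1 : EuclideanSpace ℝ (Fin (d + 1))) i
    linarith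
  have := mul_le_mul_of_nonneg_left h1 p.2.2.1
  linarith

theorem exists_simplexPolar_eq {d : ℕ} (p : UnitSphere d × unitInterval) :
    ∃ i, simplexPolar p i = (1 - (p.2 : ℝ)) / (d + 2) := by
  obtain ⟨i, hi⟩ := exists_depth_eq (p.1 : EuclideanSpace ℝ (Fin (d + 1)))
  have h := p.1.depth_pos
  refine ⟨i, ?_⟩
  have : sumZeroLift (p.1 : EuclideanSpace ℝ (Fin (d + 1))) i /
      depth (p.1 : EuclideanSpace ℝ (Fin (d + 1))) = -1 := by
    rw [div_eq_iff h.ne']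
    linarith
  rw [simplexPolar, this]
  ring

theorem simplexPolar_nonneg {d : ℕ} (p : UnitSphere d × unitInterval) (i : Fin (d + 2)) :
    0 ≤ simplexPolar p i :=
  (div_nonneg (sub_nonneg.2 p.2.2.2) (by positivity)).trans (le_simplexPolar p i)

theorem simplexPolar_zero {d : ℕ} (s s' : UnitSphere d) :
    simplexPolar (s, 0) = simplexPolar (s', 0) := by
  ext i
  simp [simplexPolar]

theorem simplexPolar_injective {d : ℕ} {s s' : UnitSphere d} {τ τ' : unitInterval}
    (h : simplexPolar (s, τ) = simplexPolar (s', τ')) : τ = τ' ∧ (τ = 0 ∨ s = s') := by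
  have hd : (0 : ℝ) < d + 2 := by positivity
  obtain ⟨i, hi⟩ := exists_simplexPolar_eq (s, τ)
  obtain ⟨j, hj⟩ := exists_simplexPolar_eq (s', τ')
  have h1 := le_simplexPolar (s', τ') i
  have h2 := le_simplexPolar (s, τ) j
  rw [← h, hi, div_le_div_iff_of_pos_right hd] at h1
  rw [h, hj, div_le_div_iff_of_pos_right hd] at h2
  have hτ : τ = τ' := Subtype.ext (by simp only at h1 h2; linarith)
  subst hτ
  refine ⟨rfl, or_iff_not_imp_left.2 fun hτ0 => ?_⟩
  have hτ' : (τ : ℝ) ≠ 0 := fun h' => hτ0 (Subtype.ext h')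
  have hs := s.depth_pos
  have hs' := s'.depth_pos
  set c := depth (s : EuclideanSpace ℝ (Fin (d + 1))) /
    depth (s' : EuclideanSpace ℝ (Fin (d + 1))) with hc
  have hc0 : 0 < c := div_pos hs hs'
  have heq : (s : EuclideanSpace ℝ (Fin (d + 1))) = c • (s' : EuclideanSpace ℝ (Fin (d + 1))) := by
    refine sumZeroLift_injective ?_
    rw [sumZeroLift_smul]
    ext i
    have := congrFun h i
    simp only [simplexPolar] at this
    rw [div_left_inj' hd.ne', add_right_inj, mul_right_inj' hτ', div_eq_div_iff hs.ne' hs'.ne']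
      at this
    rw [Pi.smul_apply, smul_eq_mul, hc, div_mul_eq_mul_div, eq_div_iff hs'.ne', this]
    ring
  have hn := congrArg norm heq
  rw [norm_smul, mem_sphere_zero_iff_norm.1 s.2, mem_sphere_zero_iff_norm.1 s'.2, mul_one,
    Real.norm_of_nonneg hc0.le] at hn
  rw [← hn, one_smul] at heq
  exact Subtype.ext heq

theorem exists_simplexPolar {d : ℕ} {y : Fin (d + 2) → ℝ} (h0 : ∀ i, 0 ≤ y i)
    (h1 : ∑ i, y i = 1) : ∃ p, simplexPolar (d := d) p = y := by
  have hd : (0 : ℝ) < d + 2 := by positivity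
  -- This is the rescaled deviation of y from the barycentre; coordinate 0 is recovered from the
  -- vanishing sum. Its depth, at most 1 because y ≥ 0, is the radius sought.
  let x : EuclideanSpace ℝ (Fin (d + 1)) := WithLp.toLp 2 fun i => (d + 2) * y i.succ - 1
  have hx : ∀ i, sumZeroLift x i = (d + 2) * y i - 1 := by
    intro i
    refine Fin.cases ?_ (fun i => ?_) i
    · rw [Fin.sum_univ_succ] at h1
      simp only [sumZeroLift, Fin.cons_zero, x, Finset.sum_sub_distrib, ← Finset.mul_sum]
      simp only [Finset.sum_const, Finset.card_univ, Fintype.card_fin, nsmul_eq_mul]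
      push_cast
      linear_combination (-(d : ℝ) - 2) * h1
    · simp [sumZeroLift, x]
  by_cases hx0 : x = 0
  · refine ⟨(UnitSphere.base d, 0), ?_⟩
    ext i
    have : sumZeroLift x i = 0 := by
      rw [hx0]
      refine Fin.cases ?_ (fun i => ?_) i <;> simp [sumZeroLift]
    rw [hx] at this
    simp only [simplexPolar, Set.Icc.coe_zero, zero_mul, add_zero]
    rw [div_eq_iff hd.ne']
    linarith
  · have hn : 0 < ‖x‖ := norm_pos_iff.2 hx0
    have hD := depth_pos hx0
    have hD1 : depth x ≤ 1 := by
      obtain ⟨i, hi⟩ := exists_depth_eq x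
      rw [hi, hx]
      have := mul_nonneg hd.le (h0 i)
      linarith
    refine ⟨(⟨‖x‖⁻¹ • x, ?_⟩, ⟨depth x, hD.le, hD1⟩), ?_⟩
    · rw [mem_sphere_zero_iff_norm, norm_smul, norm_inv, norm_norm, inv_mul_cancel₀ hn.ne']
    · ext i
      simp only [simplexPolar, sumZeroLift_smul, depth_smul (inv_nonneg.2 hn.le), Pi.smul_apply,
        smul_eq_mul, hx]
      field_simp
      ring

variable {ι : Type*} [DecidableEq ι]

/-- The point of the simplex on `F` with given barycentric coordinates. -/
def simplexPoint {d : ℕ} {F : Finset ι} (e : F ≃ Fin (d + 2)) (y : Fin (d + 2) → ℝ) (v : ι) : ℝ :=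
  if h : v ∈ F then y (e ⟨v, h⟩) else 0

theorem continuous_simplexPoint {d : ℕ} {F : Finset ι} (e : F ≃ Fin (d + 2)) :
    Continuous (simplexPoint e) := by
  refine continuous_pi fun v => ?_
  by_cases h : v ∈ F
  · simpa only [simplexPoint, dif_pos h] using continuous_apply _
  · simpa only [simplexPoint, dif_neg h] using continuous_const

theorem simplexPoint_injective {d : ℕ} {F : Finset ι} (e : F ≃ Fin (d + 2)) :
    Function.Injective (simplexPoint e) := by
  intro y y' h
  ext i
  simpa [simplexPoint] using congrFun h (e.symm i)

theorem sum_simplexPoint {d : ℕ} {F : Finset ι} (e : F ≃ Fin (d + 2)) (y : Fin (d + 2) → ℝ) :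
    ∑ v ∈ F, simplexPoint e y v = ∑ i, y i := by
  rw [← Finset.sum_coe_sort, ← e.sum_comp]
  refine Finset.sum_congr rfl fun v _ => ?_
  simp [simplexPoint]

theorem isCompact_simplexUnion {K : Set (Finset ι)} (hK : K.Finite) :
    IsCompact (simplexUnion K) := by
  have : simplexUnion K = ⋃ s ∈ K,
      {x : ι → ℝ | (∀ v, 0 ≤ x v) ∧ (∀ v, v ∉ s → x v = 0) ∧ ∑ v ∈ s, x v = 1} := by
    ext x
    simp only [simplexUnion, Set.mem_ofPred_eq, Set.mem_iUnion]
    constructor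
    · rintro ⟨h0, s, hs, h1⟩
      exact ⟨s, hs, h0, h1⟩
    · rintro ⟨s, hs, h0, h1⟩
      exact ⟨h0, s, hs, h1⟩
  rw [this]
  refine hK.isCompact_biUnion fun s _ => ?_
  refine (isCompact_univ_pi fun _ : ι => isCompact_Icc (a := (0 : ℝ)) (b := 1)).of_isClosed_subset
    ?_ ?_
  · simp only [Set.ofPred_and, Set.ofPred_forall]
    refine (isClosed_iInter fun v => isClosed_le continuous_const (continuous_apply v)).inter
      ((isClosed_iInter fun v => isClosed_iInter fun _ =>
        isClosed_eq (continuous_apply v) continuous_const).inter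
        (isClosed_eq (continuous_finsetSum _ fun i _ => continuous_apply i) continuous_const))
  · rintro x ⟨h0, hs, h1⟩ v -
    refine ⟨h0 v, ?_⟩
    by_cases hv : v ∈ s
    · rw [← h1]
      exact Finset.single_le_sum (fun i _ => h0 i) hv
    · rw [hs v hv]
      exact zero_le_one

/-- A complex with a maximal face `F` is the mapping cone of the inclusion of the boundary of `F`
into the complex without `F`. -/
theorem exists_homeomorph_mappingCone {K : Set (Finset ι)} (hK : IsLowerSet K) (hfin : K.Finite)
    {F : Finset ι} (hF : F ∈ K) (hmax : ∀ s ∈ K, F ⊆ s → s = F) {d : ℕ} (hd : F.card = d + 2) :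
    ∃ φ : C(UnitSphere d, simplexUnion (K \ {F})),
      (∀ s, (φ s : ι → ℝ) ∈ simplexUnion {r | r ⊂ F}) ∧
        Nonempty (MappingCone φ ≃ₜ simplexUnion K) := by
  let e : F ≃ Fin (d + 2) := F.equivFinOfCardEq hd
  let cell : UnitSphere d × unitInterval → ι → ℝ := fun p => simplexPoint e (simplexPolar p)
  have hcell : Continuous cell := (continuous_simplexPoint e).comp continuous_simplexPolar
  have hcell0 : ∀ p v, 0 ≤ cell p v := by
    intro p v
    simp only [cell, simplexPoint]
    split_ifs
    · exact simplexPolar_nonneg _ _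
    · exact le_rfl
  have hoff : ∀ p v, v ∉ F → cell p v = 0 := fun p v hv => dif_neg hv
  have hsum : ∀ p, ∑ v ∈ F, cell p v = 1 := fun p => by
    rw [sum_simplexPoint, sum_simplexPolar]
  have hcellK : ∀ p, cell p ∈ simplexUnion K := fun p => ⟨hcell0 p, F, hF, hoff p, hsum p⟩
  have hbd : ∀ s, cell (s, 1) ∈ simplexUnion {r | r ⊂ F} := by
    intro s
    obtain ⟨i, hi⟩ := exists_simplexPolar_eq (s, 1)
    have hv : cell (s, 1) (e.symm i) = 0 := by
      simp only [cell, simplexPoint, Finset.coe_mem, dif_pos, Subtype.coe_eta,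
        Equiv.apply_symm_apply, hi]
      simp
    refine ⟨hcell0 _, F.erase (e.symm i), Finset.erase_ssubset (e.symm i).2, fun v hvF => ?_, ?_⟩
    · by_cases hvi : v = e.symm i
      · rw [hvi, hv]
      · exact hoff _ v fun h => hvF (Finset.mem_erase.2 ⟨hvi, h⟩)
    · rw [Finset.sum_erase _ hv, hsum]
  have hsub : simplexUnion {r | r ⊂ F} ⊆ simplexUnion (K \ {F}) :=
    simplexUnion_mono fun r hr => ⟨hK hr.le hF, hr.ne⟩
  have hKF : simplexUnion (K \ {F}) ⊆ simplexUnion K := simplexUnion_mono Set.sdiff_subset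
  let φ : C(UnitSphere d, simplexUnion (K \ {F})) :=
    ⟨fun s => ⟨cell (s, 1), hsub (hbd s)⟩,
      (hcell.comp (continuous_id.prodMk continuous_const)).subtype_mk _⟩
  refine ⟨φ, hbd, ?_⟩
  let f : C(MappingCone φ, simplexUnion K) := MappingCone.lift
    ⟨Set.inclusion hKF, continuous_inclusion hKF⟩ ⟨fun p => ⟨cell p, hcellK p⟩, hcell.subtype_mk _⟩
    (fun s => rfl) (fun s s' => Subtype.ext (congrArg (simplexPoint e) (simplexPolar_zero s s')))
  -- The cell meets the rest of the complex only in its boundary: for τ < 1 all coordinates on F are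
  -- positive, so a face carrying the point would contain F and equal F by maximality.
  have hmix : ∀ (y : simplexUnion (K \ {F})) s τ, (y : ι → ℝ) = cell (s, τ) →
      MappingCone.inl φ y = MappingCone.cyl φ (s, τ) := by
    intro y s τ h
    rcases eq_or_ne τ 1 with rfl | hτ
    · rw [MappingCone.cyl_one]
      exact congrArg _ (Subtype.ext h)
    · exfalso
      obtain ⟨-, r, ⟨hr, hrF⟩, hr0, -⟩ := y.2
      refine hrF (hmax r hr fun v hv => ?_)
      by_contra hvr
      have h1 : cell (s, τ) v = 0 := by rw [← h, hr0 v hvr]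
      simp only [cell, simplexPoint, dif_pos hv] at h1
      have h2 := le_simplexPolar (s, τ) (e ⟨v, hv⟩)
      have h3 : 0 < (1 - (τ : ℝ)) / (d + 2) :=
        div_pos (sub_pos.2 (τ.2.2.lt_of_ne fun h' => hτ (Subtype.ext h'))) (by positivity)
      exact (h3.trans_le h2).ne' h1
  have hinj : Function.Injective f := by
    intro x x'
    induction x using MappingCone.ind with
    | hl y =>
      induction x' using MappingCone.ind with
      | hl y' => exact fun h => congrArg _ (Set.inclusion_injective hKF h)
      | hc s' τ' => exact fun h => hmix y s' τ' (congrArg Subtype.val h)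
    | hc s τ =>
      induction x' using MappingCone.ind with
      | hl y' => exact fun h => (hmix y' s τ (congrArg Subtype.val h).symm).symm
      | hc s' τ' =>
        intro h
        obtain ⟨rfl, rfl | rfl⟩ :=
          simplexPolar_injective (simplexPoint_injective e (congrArg Subtype.val h))
        · exact MappingCone.cyl_zero s s'
        · rfl
  have hsurj : Function.Surjective f := by
    rintro ⟨x, hx⟩
    obtain ⟨s, hs, hsx, hs0, hs1⟩ := exists_support_of_mem_simplexUnion hK hx
    by_cases hsF : s = F
    · subst hsF
      obtain ⟨p, hp⟩ := exists_simplexPolar (d := d) (y := fun i => x (e.symm i))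
        (fun i => hx.1 _) (by rw [e.symm.sum_comp fun v => x v, Finset.sum_coe_sort, hs1])
      refine ⟨MappingCone.cyl φ p, Subtype.ext (funext fun v => ?_)⟩
      change simplexPoint e (simplexPolar p) v = x v
      rw [hp, simplexPoint]
      split_ifs with hv
      · simp
      · exact (hs0 v hv).symm
    · exact ⟨MappingCone.inl φ ⟨x, hx.1, s, ⟨hs, hsF⟩, hs0, hs1⟩, rfl⟩
  have : CompactSpace (simplexUnion (K \ {F})) :=
    isCompact_iff_compactSpace.1 (isCompact_simplexUnion hfin.sdiff)
  exact ⟨Continuous.homeoOfEquivCompactToT2 (f := Equiv.ofBijective f ⟨hinj, hsurj⟩)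
    f.continuous⟩

/-- Complexes that are built from a contractible complex by attaching cells of positive dimensions
along contractible boundaries are contractible or wedges of spheres. -/
theorem CellularExtension.isConnectedSphereWedge {D K : Set (Finset ι)}
    (h : CellularExtension False D K) (hD : ContractibleSpace (simplexUnion D))
    (hK : IsLowerSet K) (hfin : K.Finite) : IsConnectedSphereWedge (simplexUnion K) := by
  induction h with
  | refl => exact Or.inl hD
  | vertex x hv => exact hv.elim
  | expand σ w hσ hσ0 hw h _ ih =>
    have := ih (fun s r hrs hs => ⟨hK hrs hs.1, fun h' => hs.2 (h'.trans hrs)⟩)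
      (hfin.subset fun s hs => hs.1)
    exact this.of_homotopyEquiv (nonempty_homotopyEquiv_expand hK hσ0 hw h).some
  | @cell K F C hF hmax hcard hCK hCl hC hFC _ ih =>
    obtain ⟨d, hd⟩ : ∃ d, F.card = d + 2 := ⟨F.card - 2, by omega⟩
    obtain ⟨φ, hφ, ⟨g⟩⟩ := exists_homeomorph_mappingCone hK hfin hF hmax hd
    have hY := ih (fun s r hrs hs => ⟨hK hrs hs.1, by
      rintro rfl
      exact hs.2 (hmax s hs.1 hrs)⟩) hfin.sdiff
    refine (hY.mappingCone (φ := φ) ?_).of_homotopyEquiv g.symm.toHomotopyEquiv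
    have hCY := simplexUnion_mono hCK
    have := hC.contractibleSpace hCl
    let φ' : C(UnitSphere d, simplexUnion C) :=
      ⟨fun s => ⟨φ s, simplexUnion_mono hFC (hφ s)⟩,
        (continuous_subtype_val.comp φ.continuous).subtype_mk _⟩
    -- The attaching map factors through the contractible realization of C.
    exact ((id_nullhomotopic (simplexUnion C)).comp_left φ').comp_right
      ⟨Set.inclusion hCY, continuous_inclusion hCY⟩

end Cells

/-! ### Finite discrete spaces as wedges of 0-spheres -/

section Discrete

open ContinuousMap

/-- The point of the zero-dimensional sphere opposite to the base point. -/
noncomputable def UnitSphere.antipode : UnitSphere 0 := -UnitSphere.base 0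

theorem UnitSphere.eq_base_or_antipode (x : UnitSphere 0) :
    x = UnitSphere.base 0 ∨ x = UnitSphere.antipode := by
  have h : ((x : EuclideanSpace ℝ (Fin 1)) 0) ^ 2 = 1 := by
    have := EuclideanSpace.real_norm_sq_eq (x : EuclideanSpace ℝ (Fin 1))
    rw [mem_sphere_zero_iff_norm.1 x.2] at this
    simpa using this.symm
  rcases mul_self_eq_one_iff.1 ((sq _).symm.trans h) with h | h
  · left
    refine Subtype.ext (PiLp.ext fun i => ?_)
    rw [Fin.fin_one_eq_zero i]
    simpa [UnitSphere.base] using h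
  · right
    refine Subtype.ext (PiLp.ext fun i => ?_)
    rw [Fin.fin_one_eq_zero i]
    simpa [UnitSphere.base, UnitSphere.antipode] using h

theorem UnitSphere.antipode_ne_base : UnitSphere.antipode ≠ UnitSphere.base 0 := by
  intro h
  have := congrArg (fun x : UnitSphere 0 => (x : EuclideanSpace ℝ (Fin 1)) 0) h
  simp [UnitSphere.base, UnitSphere.antipode] at this
  norm_num at this

instance : Finite (UnitSphere 0) :=
  Set.finite_univ_iff.1 ((Set.toFinite {UnitSphere.base 0, UnitSphere.antipode}).subset
    fun x _ => x.eq_base_or_antipode)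

open Classical in
/-- A wedge of zero-dimensional spheres is a finite discrete space. -/
noncomputable def wedgeOfZeroSpheresHomeomorph (k : ℕ) :
    WedgeOfSpheres (fun _ : Fin (k + 1) => 0) ≃ₜ Fin (k + 2) where
  toFun := WedgeOfSpheres.lift (n := fun _ : Fin (k + 1) => 0)
    (fun i => ⟨fun x => if x = UnitSphere.base 0 then 0 else i.succ, continuous_of_discreteTopology⟩)
    0 (fun i => if_pos rfl)
  invFun := Fin.cases (WedgeOfSpheres.base _) fun i =>
    WedgeOfSpheres.incl (fun _ : Fin (k + 1) => 0) i UnitSphere.antipode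
  left_inv x := by
    obtain ⟨⟨i, y⟩, rfl⟩ := Quot.exists_rep x
    rcases y.eq_base_or_antipode with rfl | rfl
    · have : (WedgeOfSpheres.lift (n := fun _ : Fin (k + 1) => 0)
        (fun i => ⟨fun x => if x = UnitSphere.base 0 then (0 : Fin (k + 2)) else i.succ,
          continuous_of_discreteTopology⟩) 0 (fun i => if_pos rfl))
          (Quot.mk _ ⟨i, UnitSphere.base 0⟩) = 0 := if_pos rfl
      rw [this]
      exact (WedgeOfSpheres.mk_base (fun _ : Fin (k + 1) => 0) i).symm
    · have : (WedgeOfSpheres.lift (n := fun _ : Fin (k + 1) => 0)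
        (fun i => ⟨fun x => if x = UnitSphere.base 0 then (0 : Fin (k + 2)) else i.succ,
          continuous_of_discreteTopology⟩) 0 (fun i => if_pos rfl))
          (Quot.mk _ ⟨i, UnitSphere.antipode⟩) = i.succ := if_neg UnitSphere.antipode_ne_base
      rw [this]
      rfl
  right_inv i := by
    refine Fin.cases ?_ (fun i => ?_) i
    · exact if_pos rfl
    · exact if_neg UnitSphere.antipode_ne_base
  continuous_toFun := ContinuousMap.continuous _
  continuous_invFun := continuous_of_discreteTopology

/-- Finite discrete spaces are wedges of zero-dimensional spheres. -/
theorem contractibleSpace_or_wedge_of_finite (X : Type*) [TopologicalSpace X] [T1Space X]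
    [Finite X] [Nonempty X] :
    ContractibleSpace X ∨ ∃ (k : ℕ) (n : Fin (k + 1) → ℕ),
      Nonempty (HomotopyEquiv X (WedgeOfSpheres n)) := by
  obtain ⟨m, ⟨e⟩⟩ := Finite.exists_equiv_fin X
  let g : X ≃ₜ Fin m := ⟨e, continuous_of_discreteTopology, continuous_of_discreteTopology⟩
  match m, g with
  | 0, g => exact (g (Classical.arbitrary X)).elim0
  | 1, g =>
    left
    have : Unique X := g.toEquiv.unique
    infer_instance
  | k + 2, g =>
    exact Or.inr ⟨k, fun _ => 0,
      ⟨(g.trans (wedgeOfZeroSpheresHomeomorph k).symm).toHomotopyEquiv⟩⟩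

theorem finite_simplexUnion {ι : Type*} [DecidableEq ι] {K : Set (Finset ι)} (hK : K.Finite)
    (h : ∀ s ∈ K, s.card ≤ 1) : (simplexUnion K).Finite := by
  refine (hK.image fun s v => if v ∈ s then 1 else 0).subset ?_
  rintro x ⟨h0, s, hs, hs0, hs1⟩
  refine ⟨s, hs, funext fun v => ?_⟩
  simp only
  split_ifs with hv
  · have : s = {v} := Finset.eq_singleton_iff_unique_mem.2
      ⟨hv, fun w hw => Finset.card_le_one.1 (h s hs) w hw v hv⟩
    rw [this, Finset.sum_singleton] at hs1
    exact hs1.symm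
  · exact (hs0 v hv).symm

end Discrete

/-! ### The Young complex as a threshold complex -/

section Young

/-- The condition on `m` for the number `x = j + 1 + t * m` to lie in the `j`-th column of `μ`, not
below its last cell. -/
def youngThreshold (t : ℕ) (μ : YoungDiagram) (x m : ℕ) : Prop :=
  x ≤ μ.rowLen 0 + t * m ∧ (t * m < x → μ.colLen 0 ≤ m + μ.colLen (x - 1 - t * m))

/-- Raising m moves x to an earlier, hence no shorter, column, and lowering x does the same; passing
to (x + t, m + 1) stays in the column one level up. Levels with tm ≥ x count as admissible here,
which keeps the condition an up-set; the growth bound from the virtual element 0 excludes them. -/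
theorem isThreshold_youngThreshold (t : ℕ) (μ : YoungDiagram) :
    IsThreshold t (youngThreshold t μ) where
  mono := by
    rintro x m m' ⟨h1, h2⟩ hm
    have hm' : t * m ≤ t * m' := Nat.mul_le_mul_left t hm
    refine ⟨by omega, fun h => (h2 (by omega)).trans (Nat.add_le_add hm ?_)⟩
    exact μ.colLen_anti _ _ (by omega)
  anti := by
    rintro x y m ⟨h1, h2⟩ hxy
    refine ⟨by omega, fun h => (h2 (by omega)).trans (Nat.add_le_add le_rfl ?_)⟩
    exact μ.colLen_anti _ _ (by omega)
  shift := by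
    rintro x m ⟨h1, h2⟩
    have hm : t * (m + 1) = t * m + t := by ring
    refine ⟨by omega, fun h => ?_⟩
    have := h2 (by omega)
    have hx : x + t - 1 - t * (m + 1) = x - 1 - t * m := by omega
    rw [hx]
    omega

theorem colLen_pos_of_lt {μ : YoungDiagram} {j : ℕ} (hj : j < μ.rowLen 0) : 0 < μ.colLen j :=
  YoungDiagram.mem_iff_lt_colLen.1 (YoungDiagram.mem_iff_lt_rowLen.2 hj)

/-- The largest number in the filling. -/
def youngMax (t : ℕ) (μ : YoungDiagram) : ℕ := μ.rowLen 0 + t * (μ.colLen 0 - 1)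

theorem youngThreshold_max {t : ℕ} {μ : YoungDiagram} {x : ℕ}
    (hx : x ≤ youngMax t μ) : youngThreshold t μ x (μ.colLen 0 - 1) := by
  refine ⟨hx, fun h => ?_⟩
  rw [youngMax] at hx
  have := colLen_pos_of_lt (μ := μ) (j := x - 1 - t * (μ.colLen 0 - 1)) (by omega)
  omega

theorem le_add_div_of_mul_le {t a b c : ℕ} (ht : 0 < t) (h : a * t ≤ b * t + c) :
    a ≤ b + c / t := by
  rw [← Nat.mul_add_div ht, Nat.le_div_iff_mul_le ht]
  linarith

theorem mul_le_of_le_add_div {t a b c : ℕ} (h : a ≤ b + c / t) : a * t ≤ b * t + c :=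
  calc a * t ≤ (b + c / t) * t := Nat.mul_le_mul_right t h
    _ = b * t + c / t * t := by ring
    _ ≤ b * t + c := Nat.add_le_add_left (Nat.div_mul_le_self c t) _

theorem mem_thresholdFaces_of_mem_youngComplex {t : ℕ} (ht : 0 < t) {μ : YoungDiagram}
    {s : Finset ℕ} (hs : s ∈ (youngComplex t μ).faces) :
    s ∈ thresholdFaces t (youngMax t μ) (youngThreshold t μ) 0 1 0 := by
  obtain ⟨-, a, ⟨hmono, ha⟩, hsa⟩ := hs
  have h : ∀ x ∈ s, ∃ j m : ℕ, (∃ hj : j < μ.rowLen 0, a ⟨j, hj⟩ = x) ∧ x = m * t + (j + 1) ∧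
      m + 1 ≤ μ.colLen 0 ∧ μ.colLen 0 ≤ m + μ.colLen j := by
    intro x hx
    obtain ⟨j, -, hj⟩ := Finset.mem_image.1 (hsa hx)
    obtain ⟨i, hi, hij⟩ := ha j
    have h1 := YoungDiagram.mem_iff_lt_colLen.1 hi
    have h2 := μ.colLen_anti 0 j (Nat.zero_le _)
    exact ⟨j, μ.colLen 0 - (i + 1), ⟨j.2, hj⟩, by rw [← hj, hij, youngEntry], by omega, by omega⟩
  choose! j m h1 h2 h3 h4 using h
  refine ⟨m, fun x hx => ?_, fun x hx y hy hxy => ?_⟩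
  · obtain ⟨hj, -⟩ := h1 x hx
    have hx2 := h2 x hx
    have hm : m x * t ≤ t * (μ.colLen 0 - 1) := by
      rw [mul_comm]
      exact Nat.mul_le_mul_left t (by have := h3 x hx; omega)
    refine ⟨by omega, by rw [youngMax]; omega, ⟨by rw [mul_comm t]; omega, fun _ => ?_⟩, ?_⟩
    · have : x - 1 - t * m x = j x := by
        rw [mul_comm t]
        omega
      rw [this]
      exact h4 x hx
    · exact le_add_div_of_mul_le ht (by omega)
  · have hj : j x < j y := by
      obtain ⟨hjx, hax⟩ := h1 x hx
      obtain ⟨hjy, hay⟩ := h1 y hy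
      rw [← hax, ← hay, hmono.lt_iff_lt] at hxy
      exact hxy
    have hx2 := h2 x hx
    have hy2 := h2 y hy
    exact le_add_div_of_mul_le ht (by omega)

/-- A generator containing s is rebuilt in two stages: p makes the levels weakly increasing on s and
at most r - 1, and q extends them to all columns as the least weakly increasing function above both
the diagram's lower bounds and p. -/
theorem mem_youngComplex_of_mem_thresholdFaces {t : ℕ} {μ : YoungDiagram}
    {s : Finset ℕ} (hs0 : s.Nonempty)
    (hs : s ∈ thresholdFaces t (youngMax t μ) (youngThreshold t μ) 0 1 0) :
    s ∈ (youngComplex t μ).faces := by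
  obtain ⟨m, h1, h2⟩ := hs
  set r := μ.colLen 0 with hr
  have hμ : 0 < μ.rowLen 0 := by
    by_contra! h
    obtain ⟨x, hx⟩ := hs0
    have h3 := (h1 x hx).2.2.1.1
    have h4 := mul_le_of_le_add_div (h1 x hx).2.2.2
    have := (h1 x hx).1
    rw [mul_comm] at h4
    omega
  -- The running maximum keeps the growth bounds, since earlier points are restrictive as well;
  -- truncation at r - 1 is harmless because the top row is admissible everywhere up to the maximum.
  let p : ℕ → ℕ := fun x => min (r - 1) ((s.filter (· ≤ x)).sup m)
  have hp_mono : Monotone p := fun x y hxy =>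
    min_le_min le_rfl (Finset.sup_mono (Finset.monotone_filter_right _ fun z _ hz => hz.trans hxy))
  have hp_r : ∀ x, p x ≤ r - 1 := fun x => min_le_left _ _
  have hp_growth : ∀ x ∈ s, ∀ y, x < y → p y ≤ p x + (y - x - 1) / t := by
    intro x hx y hxy
    rcases le_or_gt (r - 1) ((s.filter (· ≤ x)).sup m) with h | h
    · have : p x = r - 1 := min_eq_left h
      rw [this]
      exact (hp_r y).trans (Nat.le_add_right _ _)
    have hpx : p x = (s.filter (· ≤ x)).sup m := min_eq_right h.le
    rw [hpx]
    refine (min_le_right _ _).trans (Finset.sup_le fun z hz => ?_)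
    obtain ⟨hzs, hzy⟩ := Finset.mem_filter.1 hz
    have hle : ∀ u ∈ s, u ≤ x → m u ≤ (s.filter (· ≤ x)).sup m := fun u hu hux =>
      Finset.le_sup (Finset.mem_filter.2 ⟨hu, hux⟩)
    rcases le_or_gt z x with hzx | hzx
    · exact (hle z hzs hzx).trans (Nat.le_add_right _ _)
    · refine (h2 x hx z hzs hzx).trans (Nat.add_le_add (hle x hx le_rfl) ?_)
      exact Nat.div_le_div_right (by omega)
  have hp_zero : ∀ x ∈ s, p x * t + 1 ≤ x := by
    intro x hx
    have hx1 := (h1 x hx).1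
    have : p x ≤ 0 + (x - 1) / t := by
      refine (min_le_right _ _).trans (Finset.sup_le fun z hz => ?_)
      obtain ⟨hzs, hzx⟩ := Finset.mem_filter.1 hz
      refine (h1 z hzs).2.2.2.trans (Nat.add_le_add le_rfl ?_)
      exact Nat.div_le_div_right (by omega)
    have := mul_le_of_le_add_div this
    omega
  have hp_G : ∀ x ∈ s, youngThreshold t μ x (p x) := by
    intro x hx
    obtain ⟨-, hxV, hxG, -⟩ := h1 x hx
    rcases min_choice (r - 1) ((s.filter (· ≤ x)).sup m) with h | h
    · simp only [p, h]
      exact youngThreshold_max hxV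
    · simp only [p, h]
      exact (isThreshold_youngThreshold t μ).mono hxG
        (Finset.le_sup (Finset.mem_filter.2 ⟨hx, le_rfl⟩))
  let q : ℕ → ℕ := fun j => max (r - μ.colLen j) ((s.filter fun x => x - 1 - t * p x ≤ j).sup p)
  have hq_mono : Monotone q := fun i j hij =>
    max_le_max (Nat.sub_le_sub_left (μ.colLen_anti i j hij) r)
      (Finset.sup_mono (Finset.monotone_filter_right _ fun z _ hz => hz.trans hij))
  have hq_r : ∀ j, j < μ.rowLen 0 → q j ≤ r - 1 := by
    intro j hj
    have := colLen_pos_of_lt hj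
    exact max_le (by omega) (Finset.sup_le fun z _ => hp_r z)
  have hq_s : ∀ x ∈ s, q (x - 1 - t * p x) = p x := by
    intro x hx
    have hx0 := hp_zero x hx
    rw [mul_comm] at hx0
    refine le_antisymm (max_le ?_ (Finset.sup_le fun z hz => ?_)) (le_max_of_le_right
      (Finset.le_sup (Finset.mem_filter.2 ⟨hx, le_rfl⟩)))
    · have := (hp_G x hx).2 (by omega)
      omega
    · obtain ⟨hzs, hzx⟩ := Finset.mem_filter.1 hz
      -- A later point z of s lies in a strictly later column by the growth bound, so it cannot
      -- contribute to q at the column of x.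
      rcases le_or_gt z x with h | h
      · exact hp_mono h
      · have hg := mul_le_of_le_add_div (hp_growth x hx z h)
        have hz0 := hp_zero z hzs
        rw [mul_comm t, mul_comm t] at hzx
        rw [mul_comm t] at hx0
        omega
  have hr1 : 0 < r := colLen_pos_of_lt hμ
  refine ⟨hs0, fun j => q j * t + (j + 1), ⟨fun i j hij => ?_, fun j => ?_⟩, fun x hx => ?_⟩
  · have := Nat.mul_le_mul_right t (hq_mono (Fin.lt_def.1 hij).le)
    have := Fin.lt_def.1 hij
    simp only
    omega
  · have h3 := hq_r j j.2
    have h4 : r - μ.colLen j ≤ q j := le_max_left _ _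
    have h5 := colLen_pos_of_lt j.2
    refine ⟨r - 1 - q j, YoungDiagram.mem_iff_lt_colLen.2 (by omega), ?_⟩
    have h6 : r - (r - 1 - q j + 1) = q j := by omega
    rw [youngEntry, ← hr, h6]
  · have hx0 := hp_zero x hx
    rw [mul_comm] at hx0
    have hxn := (hp_G x hx).1
    refine Finset.mem_image.2 ⟨⟨x - 1 - t * p x, by omega⟩, Finset.mem_univ _, ?_⟩
    simp only [hq_s x hx, mul_comm (p x)]
    omega

/-- The faces of the `t`-Young complex in terms of thresholds. -/
theorem simplexUnion_thresholdFaces_eq {t : ℕ} (ht : 0 < t) (μ : YoungDiagram) :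
    simplexUnion (thresholdFaces t (youngMax t μ) (youngThreshold t μ) 0 1 0) =
      (youngComplex t μ).realization := by
  ext x
  constructor
  · rintro ⟨h0, s, hs, hs0, hs1⟩
    refine ⟨h0, s, mem_youngComplex_of_mem_thresholdFaces ?_ hs, hs0, hs1⟩
    rw [Finset.nonempty_iff_ne_empty]
    rintro rfl
    simp at hs1
  · rintro ⟨h0, s, hs, hs0, hs1⟩
    exact ⟨h0, s, mem_thresholdFaces_of_mem_youngComplex ht hs, hs0, hs1⟩

theorem finite_thresholdFaces {t V : ℕ} {G : ℕ → ℕ → Prop} {a b c : ℕ} :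
    (thresholdFaces t V G a b c).Finite := by
  refine (Finset.finite_toSet (Finset.Iic V).powerset).subset ?_
  rintro s ⟨m, h1, -⟩
  rw [Finset.mem_coe, Finset.mem_powerset]
  exact fun x hx => Finset.mem_Iic.2 (h1 x hx).2.1

/-- The `t`-Young complex of a diagram with at least two columns. -/
theorem isConnectedSphereWedge_youngComplex {t : ℕ} (ht : 0 < t) {μ : YoungDiagram}
    (hμ : 2 ≤ μ.rowLen 0) : IsConnectedSphereWedge (youngComplex t μ).realization := by
  have hr : 0 < μ.colLen 0 := colLen_pos_of_lt (by omega)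
  obtain ⟨p, hp⟩ := cellularExtension_thresholdFaces_of_link_ne (V := youngMax t μ)
    (isThreshold_youngThreshold t μ) ht
    -- The number kt + 1 at level k is in column 0, which has full length r.
    (fun k _ => ⟨by rw [mul_comm]; omega, fun _ => by
      rw [show k * t + 1 - 1 - t * k = 0 by rw [mul_comm]; omega]
      omega⟩)
    (fun k hk h => by
      -- The largest entry at level r - 1 lies in every link: the growth bound reduces to (r - 1)t ≤
      -- n + (r - 1)t - 2 with n columns, which is where n ≥ 2 enters.
      have : {youngMax t μ} ∈ thresholdFaces t (youngMax t μ) (youngThreshold t μ) (k * t + 1)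
          ((k + 1) * t + 1) k := by
        refine ⟨fun _ => μ.colLen 0 - 1, fun x hx => ?_, fun x hx y hy hxy => ?_⟩
        · obtain rfl := Finset.mem_singleton.1 hx
          refine ⟨hk, le_rfl, youngThreshold_max le_rfl,
            le_add_div_of_mul_le ht ?_⟩
          have h1 : (k + 1) * t = k * t + t := by ring
          change (μ.colLen 0 - 1) * t ≤ _
          rw [youngMax, mul_comm t] at hk ⊢
          omega
        · rw [Finset.mem_singleton.1 hx, Finset.mem_singleton.1 hy] at hxy
          exact absurd hxy (lt_irrefl _)
      rw [h] at this
      simp at this) 0 (by rw [youngMax]; omega)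
  rw [zero_mul, zero_add] at hp
  rw [← simplexUnion_thresholdFaces_eq ht μ]
  refine hp.isConnectedSphereWedge ?_ isLowerSet_thresholdFaces finite_thresholdFaces
  refine contractibleSpace_simplexUnion_cone p (Or.inl rfl) ?_
  rintro s (rfl | rfl) <;> simp

end Young

theorem mainTheorem2 (t : ℕ) (ht : 0 < t) (μ : YoungDiagram) (hμ : μ ≠ ⊥) :
    ContractibleSpace (youngComplex t μ).realization ∨
      ∃ (k : ℕ) (n : Fin (k + 1) → ℕ),
        Nonempty (ContinuousMap.HomotopyEquiv (youngComplex t μ).realization (WedgeOfSpheres n)) := by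
  have h0 : 0 < μ.rowLen 0 := by
    by_contra! h
    refine hμ ((eq_bot_iff).2 fun c hc => ?_)
    have := YoungDiagram.mem_iff_lt_rowLen.1 (μ.up_left_mem (Nat.zero_le c.1) le_rfl hc)
    omega
  -- With one column every face is a single vertex, so the realization is finite and discrete.
  rcases Nat.lt_or_ge 1 (μ.rowLen 0) with h | h
  · exact (isConnectedSphereWedge_youngComplex ht h).imp_right
      fun ⟨k, n, _, e⟩ => ⟨k, n, e⟩
  · have hfin : Finite (youngComplex t μ).realization := by
      refine finite_simplexUnion (youngComplex_faces_finite t μ) ?_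
      rintro s ⟨-, a, -, hsa⟩
      refine (Finset.card_le_card hsa).trans (Finset.card_image_le.trans ?_)
      simpa using h
    have hne : Nonempty (youngComplex t μ).realization := by
      rw [← simplexUnion_thresholdFaces_eq ht μ]
      refine ⟨⟨_, single_mem_simplexUnion (w := youngMax t μ) ?_⟩⟩
      refine ⟨fun _ => μ.colLen 0 - 1, fun x hx => ?_, fun x hx y hy hxy => ?_⟩
      · obtain rfl := Finset.mem_singleton.1 hx
        refine ⟨by rw [youngMax]; omega, le_rfl, youngThreshold_max le_rfl,
          le_add_div_of_mul_le ht ?_⟩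
        change (μ.colLen 0 - 1) * t ≤ _
        rw [youngMax, mul_comm t]
        omega
      · rw [Finset.mem_singleton.1 hx, Finset.mem_singleton.1 hy] at hxy
        exact absurd hxy (lt_irrefl _)
    exact contractibleSpace_or_wedge_of_finite _
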